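/- Fix integers $m,n\ge 0$. *Square paths.* A square path (ending east) of size $N$ is a lattice path from $(0,0)$ to $(N,N)$ with unit north and east steps whose last step is east. Its shift is $s\ge 0$, where $y=x-s$ is the lowest diagonal (slope $1$) touched by the path, called the base diagonal. For $1\le i\le N$ let $a_i$ be the integer such that the $i$-th vertical step (counted from the bottom) starts on the diagonal $y=x+a_i$. *Preference and parking functions.* A partial preference function $P\in\mathsf{Pref}(m,n)$ is a square path of size $m+n$ together with labels $w_1,\dots,w_{m+n}\in\mathbb{N}$ of its vertical steps, from bottom to top, such that exactly $m$ labels are $0$ and the nonzero labels are exactly $1,\dots,n$; the labels in each column are strictly increasing from bottom to top; at least one vertical step starting on the base diagonal has a nonzero label; and, if the path starts with a vertical step, then that step has a nonzero label. The set $\mathsf{Park}(m,n)$ of partial parking functions consists of those $P\in\mathsf{Pref}(m,n)$ with shift $0$. *Statistics.* For $P\in\mathsf{Pref}(m,n)$ with shift $s$, put $\mathrm{area}(P)=\sum_{i=1}^{m+n}(a_i+s)$ and let $$\mathrm{dinv}(P)=\#\{i<j: a_i=a_j,\ w_i<w_j\}+\#\{i<j: a_i=a_j+1,\ w_i>w_j\}+\#\{i: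 a_i<0,\ w_i\ne 0\}.$$ The diagonal word $\mathrm{diagword}(P)$ lists all labels of $P$, one diagonal $y=x+d$ after the other from the highest to the lowest, and in increasing order on each diagonal. The reading word of $P$ lists its nonzero labels, one diagonal after the other from the lowest to the highest, and from bottom left to top right on each diagonal; its reversal $\sigma$ is a permutation of $1,\dots,n$, and $\mathrm{ides}(P)=\{i\in\{1,\dots,n-1\}:\sigma^{-1}(i)>\sigma^{-1}(i+1)\}$. *Quasisymmetric functions.* For $S\subseteq\{1,\dots,n-1\}$, the Gessel fundamental quasisymmetric function is $$Q_{S,n}=\sum_{\substack{1\le i_1\le i_2\le\cdots\le i_n\\ i_j<i_{j+1}\text{ if }j\in S}}x_{i_1}x_{i_2}\cdots x_{i_n},$$ and $[k]_q=1+q+\cdots+q^{k-1}$, with $[0]_q=0$. *Statement.* Let $\tau$ be a word that is a permutation of the multiset consisting of $m$ zeros and of $1,\dots,n$ once each, and let $r$ be the number of nonzero letters in the rightmost run (maximal weakly increasing substring of consecutive letters) of $\tau$. Then, as formal power series in $x_1,x_2,\dots$ over $\mathbb{Q}(q,t)$, $$\sum_{\substack{P\in\mathsf{Pref}(m,n)\\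 \mathrm{diagword}(P)=\tau}}q^{\mathrm{dinv}(P)}t^{\mathrm{area}(P)}Q_{\mathrm{ides}(P),n}=\frac{[n]_q}{[r]_q}\sum_{\substack{D\in\mathsf{Park}(m,n)\\ \mathrm{diagword}(D)=\tau}}q^{\mathrm{dinv}(D)}t^{\mathrm{area}(D)}Q_{\mathrm{ides}(D),n}.$$ If $r=0$, both sums are empty and the right-hand side is read as $0$. -/

import Mathlib

namespace ParkingQ

/-! ### Square paths -/

/-- Unit steps of a lattice path: north `(x, y) → (x, y + 1)` and east `(x, y) → (x + 1, y)`. -/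
inductive Step where
  | north : Step
  | east : Step
  deriving DecidableEq

instance : Finite Step :=
  Finite.of_injective (fun s => decide (s = Step.north)) fun a b h => by
    cases a <;> cases b <;> simp_all

/-- The list of the columns (`x`-coordinates) of the successive vertical steps, from bottom to
top, of the path with the given steps that starts at a point with `x`-coordinate `x`. -/
def columnsFrom : ℕ → List Step → List ℕ
  | _, [] => []
  | x, Step.north :: p => x :: columnsFrom x p
  | x, Step.east :: p => columnsFrom (x + 1) p

theorem length_columnsFrom (p : List Step) (x : ℕ) :
    (columnsFrom x p).length = p.count Step.north := by
  induction p generalizing x with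
  | nil => simp [columnsFrom]
  | cons s p ih => cases s <;> simp [columnsFrom, ih]

/-- A square path ending east of size `N`: a lattice path from `(0, 0)` to `(N, N)` made of north
and east unit steps, whose last step is an east step. -/
structure SquarePath (N : ℕ) where
  steps : List Step
  count_north : steps.count Step.north = N
  count_east : steps.count Step.east = N
  ends_east : steps.getLast? = some Step.east

namespace SquarePath

variable {N : ℕ}

/-- The column (`x`-coordinate) of the `i`-th vertical step (rows are numbered from `0`). -/
def col (π : SquarePath N) (i : Fin N) : ℕ :=
  (columnsFrom 0 π.steps)[(i : ℕ)]'(by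
    rw [length_columnsFrom, π.count_north]; exact i.isLt)

/-- The area word: the `i`-th vertical step starts at the point `(π.col i, i)`, which lies on the
diagonal `y = x + π.areaWord i`. -/
def areaWord (π : SquarePath N) (i : Fin N) : ℤ := (i : ℤ) - (π.col i : ℤ)

/-- The path is on the diagonal `y = x + π.height k` after its first `k` steps. -/
def height (π : SquarePath N) (k : ℕ) : ℤ :=
  ((π.steps.take k).count Step.north : ℤ) - ((π.steps.take k).count Step.east : ℤ)

/-- The base diagonal of the path is `y = x + π.base`, the lowest diagonal that it touches. -/
def base (π : SquarePath N) : ℤ :=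
  (Finset.range (π.steps.length + 1)).inf' Finset.nonempty_range_add_one π.height

/-- The shift of a square path. -/
def shift (π : SquarePath N) : ℤ := -π.base

/-- The number of whole squares between the path and its base diagonal. -/
def area (π : SquarePath N) : ℤ := ∑ i, (π.areaWord i + π.shift)

end SquarePath

/-! ### Partially labelled square paths -/

/-- Partially labelled square paths ending east, of size `m + n`, with `m` labels equal to `0`. -/
structure LSQ (m n : ℕ) where
  path : SquarePath (m + n)
  /-- The label of the `i`-th vertical step. -/
  label : Fin (m + n) → ℕ
  /-- Labels strictly increase from bottom to top in each column. -/
  column_strict : ∀ i j, i < j → path.col i = path.col j → label i < label j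
  /-- Some vertical step that starts from the base diagonal has a nonzero label. -/
  base_nonzero : ∃ i, path.areaWord i = path.base ∧ label i ≠ 0
  /-- If the path starts with a vertical step, then the label of this step is nonzero. -/
  first_nonzero : path.steps.head? = some Step.north → ∀ i : Fin (m + n), (i : ℕ) = 0 → label i ≠ 0
  card_zero : (Finset.univ.filter fun i => label i = 0).card = m

namespace LSQ

variable {m n : ℕ}

def shift (P : LSQ m n) : ℤ := P.path.shift

def area (P : LSQ m n) : ℤ := P.path.area

/-- `(i, j)` is a primary or a secondary inversion. -/
def IsInversion (P : LSQ m n) (i j : Fin (m + n)) : Prop :=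
  (P.path.areaWord i = P.path.areaWord j ∧ P.label i < P.label j) ∨
    (P.path.areaWord i = P.path.areaWord j + 1 ∧ P.label j < P.label i)

open Classical in
/-- The number of inversions plus the bonus dinv. -/
noncomputable def dinv (P : LSQ m n) : ℕ :=
  (Finset.univ.filter fun e : Fin (m + n) × Fin (m + n) => e.1 < e.2 ∧ P.IsInversion e.1 e.2).card +
    (Finset.univ.filter fun i : Fin (m + n) => P.path.areaWord i < 0 ∧ P.label i ≠ 0).card

/-- The labels on the diagonal `y = x + d`, from bottom left to top right. -/
def labelsOn (P : LSQ m n) (d : ℤ) : List ℕ :=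
  ((List.finRange (m + n)).filter fun i => P.path.areaWord i = d).map P.label

/-- The integers `-(m + n), …, m + n - 1` in increasing order: every vertical step of a square
path of size `m + n` starts on a diagonal `y = x + d` with `d` in this list. -/
def levels (m n : ℕ) : List ℤ :=
  (List.range (2 * (m + n))).map fun k : ℕ => (k : ℤ) - ((m + n : ℕ) : ℤ)

/-- The reading word: the nonzero labels, diagonal after diagonal, from the lowest diagonal to the
highest one, each diagonal from bottom left to top right. -/
def readingWord (P : LSQ m n) : List ℕ :=
  (levels m n).flatMap fun d => (P.labelsOn d).filter fun c => c ≠ 0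

/-- The diagonal word: the labels, diagonal after diagonal, from the highest diagonal to the lowest
one, in increasing order on each diagonal. -/
def diagWord (P : LSQ m n) : List ℕ :=
  (levels m n).reverse.flatMap fun d => (P.labelsOn d).mergeSort (fun a b => decide (a ≤ b))

end LSQ

/-! ### Permutation words -/

/-- The descent set `{i | u_i > u_{i+1}}` of a word `u_1 u_2 ⋯`. -/
def descents (u : List ℕ) : Finset ℕ :=
  (Finset.Ico 1 u.length).filter fun i => u.getD i 0 < u.getD (i - 1) 0

/-- The one-line notation of the inverse of a permutation `u_1 ⋯ u_n` of `1, …, n`: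
its `k`-th letter is the position of `k` in `u` (positions are numbered from `1`). -/
def inverseWord (u : List ℕ) : List ℕ :=
  (List.range u.length).map fun k => u.idxOf (k + 1) + 1

/-- The inverse descent set of a permutation of `1, …, n`. -/
def ides (u : List ℕ) : Finset ℕ := descents (inverseWord u)

/-- The words that are permutations of the multiset with `m` zeros and `1, …, n` once each. -/
def permWords (m n : ℕ) : Set (List ℕ) :=
  {τ | τ.Perm (List.replicate m 0 ++ List.range' 1 n)}

/-- The maximal weakly increasing substrings of a word, from left to right. -/
def runs (τ : List ℕ) : List (List ℕ) := τ.splitBy fun a b => decide (a ≤ b)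

/-- The number of nonzero letters in the rightmost run of a word. -/
def lastRunNonzero (τ : List ℕ) : ℕ := ((runs τ).getLastD []).countP fun c => c ≠ 0

/-! ### Preference functions and parking functions -/

/-- Partial preference functions: the nonzero labels are exactly `1, …, n`. -/
def Pref (m n : ℕ) : Set (LSQ m n) :=
  {P | {c : ℕ | c ≠ 0 ∧ ∃ i, P.label i = c} = Set.Icc 1 n}

/-- Partial parking functions: partial preference functions of shift `0`. -/
def Park (m n : ℕ) : Set (LSQ m n) := {P | P ∈ Pref m n ∧ P.shift = 0}

/-- The inverse descent set of a preference function is that of its reverse reading word. -/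
def LSQ.ides {m n : ℕ} (P : LSQ m n) : Finset ℕ := ParkingQ.ides P.readingWord.reverse

theorem SquarePath.length_steps {N : ℕ} (π : SquarePath N) : π.steps.length = N + N := by
  have h : ∀ l : List Step, l.length = l.count Step.north + l.count Step.east := by
    intro l
    induction l with
    | nil => rfl
    | cons s l ih => cases s <;> simp [ih] <;> omega
  rw [h, π.count_north, π.count_east]

theorem finite_Pref (m n : ℕ) : (Pref m n).Finite := by
  let f : Pref m n → (Fin ((m + n) + (m + n)) → Step) × (Fin (m + n) → Fin (n + 1)) := fun P =>
    (fun k => P.1.path.steps[(k : ℕ)]'(by rw [SquarePath.length_steps]; exact k.isLt),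
      fun i => ⟨P.1.label i, by
        by_cases h : P.1.label i = 0
        · omega
        · have h2 : P.1.label i ∈ Set.Icc 1 n := by
            rw [← P.2]; exact ⟨h, i, rfl⟩
          exact Nat.lt_succ_of_le h2.2⟩)
  have hf : Function.Injective f := by
    rintro ⟨⟨⟨s, h1, h2, h3⟩, w, _, _, _, _⟩, hP⟩ ⟨⟨⟨s', h1', h2', h3'⟩, w', _, _, _, _⟩, hP'⟩ h
    have hl : s.length = (m + n) + (m + n) := SquarePath.length_steps ⟨s, h1, h2, h3⟩
    have hl' : s'.length = (m + n) + (m + n) := SquarePath.length_steps ⟨s', h1', h2', h3'⟩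
    simp only [f, Prod.mk.injEq] at h
    obtain ⟨ha, hb⟩ := h
    have e1 : s = s' := by
      apply List.ext_getElem (by omega)
      intro k hk hk'
      exact congrFun ha ⟨k, by omega⟩
    have e2 : w = w' := by
      funext i
      have := congrFun hb i
      simpa using this
    subst e1
    subst e2
    rfl
  exact Set.finite_coe_iff.mp (Finite.of_injective f hf)

open Classical in
/-- The preference functions with diagonal word `τ`. -/
noncomputable def prefWith (m n : ℕ) (τ : List ℕ) : Finset (LSQ m n) :=
  (finite_Pref m n).toFinset.filter fun P => P.diagWord = τ

open Classical in
/-- The parking functions with diagonal word `τ`. -/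
noncomputable def parkWith (m n : ℕ) (τ : List ℕ) : Finset (LSQ m n) :=
  ((finite_Pref m n).subset fun _ h => h.1 : (Park m n).Finite).toFinset.filter
    fun P => P.diagWord = τ

/-! ### Coefficients and quasisymmetric functions -/

/-- The field `ℚ(q, t)`. -/
abbrev Qqt : Type := FractionRing (MvPolynomial (Fin 2) ℚ)

noncomputable def q : Qqt := algebraMap (MvPolynomial (Fin 2) ℚ) Qqt (MvPolynomial.X 0)

noncomputable def t : Qqt := algebraMap (MvPolynomial (Fin 2) ℚ) Qqt (MvPolynomial.X 1)

/-- The `q`-analogue `1 + q + ⋯ + q ^ (k - 1)` of `k`. -/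
noncomputable def qNat (k : ℕ) : Qqt := ∑ i ∈ Finset.range k, q ^ i

/-- The sequences `i_1 ≤ ⋯ ≤ i_n` of positive integers with `i_j < i_{j+1}` whenever `j ∈ S`. -/
def gesselSeqs (S : Finset ℕ) (n : ℕ) : Set (Fin n → ℕ+) :=
  {i | Monotone i ∧ ∀ j k : Fin n, (k : ℕ) = (j : ℕ) + 1 → (k : ℕ) ∈ S → i j < i k}

/-- The Gessel fundamental quasisymmetric function `Q_{S,n}` as a formal power series in
`x_1, x_2, …`: the coefficient of a monomial is the number of the sequences `i` in
`gesselSeqs S n` for which `x_{i_1} ⋯ x_{i_n}` is this monomial. -/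
noncomputable def gesselQ (S : Finset ℕ) (n : ℕ) : MvPowerSeries ℕ+ Qqt := fun d =>
  (({i | i ∈ gesselSeqs S n ∧ ∑ j, Finsupp.single (i j) 1 = d} : Set (Fin n → ℕ+)).ncard : Qqt)

/-- The term `q ^ dinv(P) t ^ area(P) Q_{ides(P), n}` of a path `P`. -/
noncomputable def LSQ.weight {m n : ℕ} (P : LSQ m n) : MvPowerSeries ℕ+ Qqt :=
  (q ^ P.dinv * t ^ P.area) • gesselQ P.ides n

end ParkingQ

/-!
A vertical step is recorded as a letter: its level above the base diagonal together with its label.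
A labelled path of shift `s` is then a word in which the level rises by at most one from a letter to
the next, and only together with the label, which starts at a level `≤ s` and ends at a level `≥ s`,
and whose first letter is nonzero if it is on level `s` (`isWord_toWord`, `exists_toWord_eq`). Since
a path that rises to a level does so by two vertical steps in one column, the runs of the diagonal
word are the sorted levels (`runs_diagWord`). Hence the diagonal word determines the letters of the
word, but not its shift, and all paths with one diagonal word have the same area.

For a fixed shift `s`, the words are built by inserting letters one at a time: first the level `s`,
then the levels above it upwards, each from its largest letter to its smallest one, and the levels
below it downwards, each from its smallest letter to its largest one. A letter can be inserted after
(or, below level `s`, before) certain letters, and its inversions are with exactly those of them that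
are behind (or before) the chosen place, so each insertion contributes a `q`-integer (`genSum_cons`).
Equal letters are dealt with by marking one of the copies. Two adjacent levels can thus be joined
upwards or downwards, and merging them into one sorted word shows that the two products agree up to
the `q`-factorials of the level sizes (`placesProd_comparison`). Therefore the generating function
of `dinv` without the bonus is `[n_s]_q` times a quantity independent of `s`, where `n_s` is the
number of nonzero labels on level `s` (`exists_wordSum_content`). The bonus is
`n_0 + ⋯ + n_{s-1}`, so the sum over all shifts is `[n]_q` times that quantity (`sum_qNat_levels`),
while the parking functions, which are the case `s = 0`, contribute `[r]_q` times it.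

The quasisymmetric functions are carried along as follows. Whether `i` is an inverse descent depends
only on the letters, unless `i` and `i + 1` are on one level. Permuting the labels within each
maximal block of consecutive labels on one level changes neither the path nor the inversions between
different blocks, so the orders within the blocks contribute a common factor, the same for all
shifts (`LSQ.sum_smul_ides`).
-/

namespace ParkingQ

/-! ### Insertion of a letter into the arrangements of a multiset -/

section Insertion

variable {α : Type*}

/-- The number of pairs `i < j` of positions of a list whose letters are related by `I`. -/
def pairCount (I : α → α → Bool) : List α → ℕ
  | [] => 0
  | x :: l => l.countP (I x) + pairCount I l

theorem pairCount_append (I : α → α → Bool) (l₁ l₂ : List α) :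
    pairCount I (l₁ ++ l₂) =
      pairCount I l₁ + pairCount I l₂ + (l₁.map fun x => l₂.countP (I x)).sum := by
  induction l₁ with
  | nil => simp [pairCount]
  | cons x l₁ ih => simp [pairCount, ih]; ring

theorem pairCount_insert (I : α → α → Bool) (c : α) (l₁ l₂ : List α)
    (h : ∀ x ∈ l₁, I x c = false) :
    pairCount I (l₁ ++ c :: l₂) = pairCount I (l₁ ++ l₂) + l₂.countP (I c) := by
  have h' : (l₁.map fun x => (c :: l₂).countP (I x)) = l₁.map fun x => l₂.countP (I x) := by
    apply List.map_congr_left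
    intro x hx
    simp [h x hx]
  rw [pairCount_append, pairCount_append, h', pairCount]
  ring

theorem pairCount_reverse (I : α → α → Bool) (l : List α) :
    pairCount I l.reverse = pairCount (fun x y => I y x) l := by
  induction l with
  | nil => rfl
  | cons x l ih =>
    rw [List.reverse_cons, pairCount_append, ih]
    simp only [pairCount, List.countP_nil, add_zero, List.countP_singleton, List.map_reverse,
      List.sum_reverse]
    have (l' : List α) : (l'.map fun y => if I y x = true then 1 else 0).sum =
        l'.countP fun y => I y x := by
      induction l' with
      | nil => rfl
      | cons y l' ih => cases hy : I y x <;> simp [hy, ih, add_comm]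
    rw [this]
    omega

/-- Whether a letter may be inserted directly after the word `l`: letters satisfying `p` may be
followed by it, and `b` says whether it may come first. -/
def eligible (b : Bool) (p : α → Bool) (l : List α) : Bool := (l.getLast?.map p).getD b

theorem eligible_nil (b : Bool) (p : α → Bool) : eligible b p [] = b := rfl

theorem eligible_cons (b : Bool) (p : α → Bool) (x : α) (l : List α) :
    eligible b p (x :: l) = eligible (p x) p l := by
  cases l with
  | nil => rfl
  | cons y l => simp [eligible, List.getLast?_cons]

theorem eligible_concat (b : Bool) (p : α → Bool) (x : α) (l : List α) :
    eligible b p (l ++ [x]) = p x := by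
  simp [eligible]

theorem qNat_succ (k : ℕ) : qNat (k + 1) = qNat k + q ^ k := Finset.sum_range_succ _ _

/-- The eligible places of a word, each weighted by the number of eligible places behind it, add up to
a `q`-integer. -/
theorem sum_eligible (p : α → Bool) (l : List α) (b : Bool) :
    ∑ i ∈ Finset.range (l.length + 1),
        (if eligible b p (l.take i) then q ^ (l.drop i).countP p else 0) =
      qNat (l.countP p + b.toNat) := by
  induction l generalizing b with
  | nil => cases b <;> simp [eligible_nil, qNat]
  | cons x l ih =>
    rw [List.length_cons, Finset.sum_range_succ']
    simp only [List.take_succ_cons, List.drop_succ_cons, eligible_cons, List.take_zero,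
      List.drop_zero, eligible_nil]
    rw [ih]
    have hx : l.countP p + (p x).toNat = (x :: l).countP p := by
      cases h : p x <;> simp [h]
    rw [hx]
    cases b <;> simp [qNat_succ]

/-- The occurrences of a letter, each weighted by the number of occurrences behind it, add up to a
`q`-integer. -/
theorem sum_occurrences [DecidableEq α] (c : α) (l : List α) :
    ∑ i ∈ Finset.range l.length, (if l[i]? = some c then q ^ (l.drop (i + 1)).count c else 0) =
      qNat (l.count c) := by
  induction l with
  | nil => simp [qNat]
  | cons x l ih =>
    rw [List.length_cons, Finset.sum_range_succ']
    simp only [List.getElem?_cons_succ, List.drop_succ_cons, List.getElem?_cons_zero,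
      List.drop_zero, Option.some.injEq]
    rw [ih]
    by_cases h : x = c
    · simp [h, qNat_succ]
    · simp [h]

variable [DecidableEq α]

/-- The arrangements of a multiset of letters as a word. -/
def arrangements (C : Multiset α) : Finset (List α) := C.lists.toFinset

theorem mem_arrangements {C : Multiset α} {l : List α} :
    l ∈ arrangements C ↔ (l : Multiset α) = C := by
  rw [arrangements, Multiset.mem_toFinset, Multiset.mem_lists_iff, eq_comm]
  rfl

open Classical in
/-- The generating function, by the number of pairs related by `I`, of the arrangements of `C`
that satisfy `V`. -/
noncomputable def genSum (V : List α → Prop) (I : α → α → Bool) (C : Multiset α) : Qqt :=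
  ∑ l ∈ (arrangements C).filter V, q ^ pairCount I l

theorem genSum_reverse (V : List α → Prop) (I : α → α → Bool) (C : Multiset α) :
    genSum (fun l => V l.reverse) (fun x y => I y x) C = genSum V I C := by
  classical
  apply Finset.sum_nbij' List.reverse List.reverse
  · intro l hl
    simp only [Finset.mem_filter, mem_arrangements] at hl ⊢
    exact ⟨by rw [← hl.1]; exact Multiset.coe_eq_coe.2 (List.reverse_perm l), hl.2⟩
  · intro l hl
    simp only [Finset.mem_filter, mem_arrangements] at hl ⊢
    exact ⟨by rw [← hl.1]; exact Multiset.coe_eq_coe.2 (List.reverse_perm l), by simpa using hl.2⟩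
  · simp
  · simp
  · intro l _
    rw [pairCount_reverse]

/-- Removal of a letter `c` that no letter before it is related to: if the places where `c` can be
inserted are those after the letters satisfying `p`, and these letters are the ones that `c` is
related to and the copies of `c`, then the insertion of `c` multiplies the generating function by a
`q`-integer, up to the choice of one of the copies of `c`. -/
theorem genSum_cons (V : List α → Prop) (I : α → α → Bool) (c : α) (p : α → Bool) (b : Bool)
    (C : Multiset α) (hc : I c c = false) (hpc : p c = true) (hbefore : ∀ x ∈ C, I x c = false)
    (hafter : ∀ x ∈ C, x ≠ c → p x = I c x)
    (hV : ∀ l₁ l₂ : List α, ((l₁ ++ l₂ : List α) : Multiset α) = C →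
      (V (l₁ ++ c :: l₂) ↔ V (l₁ ++ l₂) ∧ eligible b p l₁ = true)) :
    qNat (C.count c + 1) * genSum V I (c ::ₘ C) =
      qNat (C.countP (fun x => p x = true) + b.toNat) * genSum V I C := by
  classical
  have hcount : ∀ l : List α, (∀ x ∈ l, x ∈ C) →
      l.countP (I c) + l.count c = l.countP p := by
    intro l hl
    induction l with
    | nil => rfl
    | cons x l ih =>
      have ih' := ih fun y hy => hl y (List.mem_cons_of_mem _ hy)
      by_cases h : x = c
      · subst h
        simp [hc, hpc, ← ih', add_assoc]
      · have := hafter x (hl x List.mem_cons_self) h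
        rw [List.countP_cons, List.count_cons_of_ne h, List.countP_cons, this]
        omega
  have hL : qNat (C.count c + 1) * genSum V I (c ::ₘ C) =
      ∑ e ∈ ((arrangements (c ::ₘ C)).filter V ×ˢ Finset.range (Multiset.card C + 1)).filter
        (fun e => e.1[e.2]? = some c), q ^ (pairCount I e.1 + (e.1.drop (e.2 + 1)).count c) := by
    rw [Finset.sum_filter, Finset.sum_product, genSum, Finset.mul_sum]
    apply Finset.sum_congr rfl
    intro l hl
    simp only [Finset.mem_filter, mem_arrangements] at hl
    have h1 : Multiset.card C + 1 = l.length := by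
      rw [← Multiset.card_cons c, ← hl.1, Multiset.coe_card]
    have h2 : C.count c + 1 = l.count c := by
      rw [← Multiset.coe_count, hl.1, Multiset.count_cons_self]
    rw [h1, h2, ← sum_occurrences, Finset.sum_mul]
    apply Finset.sum_congr rfl
    intro i _
    split_ifs <;> simp [pow_add, mul_comm]
  have hR : qNat (C.countP (fun x => p x = true) + b.toNat) * genSum V I C =
      ∑ e ∈ ((arrangements C).filter V ×ˢ Finset.range (Multiset.card C + 1)).filter
        (fun e => eligible b p (e.1.take e.2) = true),
          q ^ (pairCount I e.1 + (e.1.drop e.2).countP p) := by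
    rw [Finset.sum_filter, Finset.sum_product, genSum, Finset.mul_sum]
    apply Finset.sum_congr rfl
    intro l hl
    simp only [Finset.mem_filter, mem_arrangements] at hl
    have h1 : Multiset.card C = l.length := by rw [← hl.1, Multiset.coe_card]
    have h2 : C.countP (fun x => p x = true) = l.countP p := by
      rw [← hl.1, Multiset.coe_countP]; simp
    rw [h1, h2, ← sum_eligible, Finset.sum_mul]
    apply Finset.sum_congr rfl
    intro i _
    split_ifs <;> simp [pow_add, mul_comm]
  rw [hL, hR]
  have hmem : ∀ (l : List α), (l : Multiset α) = C → ∀ x ∈ l, x ∈ C := by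
    intro l hl x hx
    rw [← hl]; exact hx
  have hins : ∀ l₁ l₂ : List α, ((l₁ ++ c :: l₂ : List α) : Multiset α) = c ::ₘ C ↔
      ((l₁ ++ l₂ : List α) : Multiset α) = C := by
    intro l₁ l₂
    have : ((l₁ ++ c :: l₂ : List α) : Multiset α) = c ::ₘ ((l₁ ++ l₂ : List α) : Multiset α) := by
      rw [Multiset.cons_coe]
      exact Multiset.coe_eq_coe.2 List.perm_middle
    rw [this, Multiset.cons_inj_right]
  have hsplit : ∀ (l : List α) (i : ℕ), l[i]? = some c →
      l.take i ++ c :: l.drop (i + 1) = l := by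
    intro l i h
    obtain ⟨hi, h⟩ := List.getElem?_eq_some_iff.1 h
    rw [← h, List.cons_getElem_drop_succ, List.take_append_drop]
  apply Finset.sum_nbij' (fun e => (e.1.take e.2 ++ e.1.drop (e.2 + 1), e.2))
    (fun e => (e.1.take e.2 ++ c :: e.1.drop e.2, e.2))
  · rintro ⟨l, i⟩ h
    simp only [Finset.mem_filter, Finset.mem_product, mem_arrangements, Finset.mem_range] at h ⊢
    obtain ⟨⟨⟨h1, h2⟩, h3⟩, h4⟩ := h
    have hs := hsplit l i h4
    have hlen : i < l.length := (List.getElem?_eq_some_iff.1 h4).1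
    rw [← hs] at h1 h2
    rw [hins] at h1
    rw [hV _ _ h1] at h2
    refine ⟨⟨⟨h1, h2.1⟩, h3⟩, ?_⟩
    rw [List.take_left' (by simp; omega)]
    exact h2.2
  · rintro ⟨l, i⟩ h
    simp only [Finset.mem_filter, Finset.mem_product, mem_arrangements, Finset.mem_range] at h ⊢
    obtain ⟨⟨⟨h1, h2⟩, h3⟩, h4⟩ := h
    have hlen : i ≤ l.length := by
      rw [← h1, Multiset.coe_card] at h3; omega
    rw [← List.take_append_drop i l] at h1 h2
    refine ⟨⟨⟨(hins _ _).2 h1, (hV _ _ h1).2 ⟨h2, h4⟩⟩, h3⟩, ?_⟩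
    rw [List.getElem?_append_right (by simp)]
    simp [hlen]
  · rintro ⟨l, i⟩ h
    simp only [Finset.mem_filter, Finset.mem_product, mem_arrangements, Finset.mem_range] at h
    have hlen : i < l.length := (List.getElem?_eq_some_iff.1 h.2).1
    simp only [Prod.mk.injEq, and_true]
    rw [List.take_left' (by simp; omega), List.drop_left' (by simp; omega)]
    exact hsplit l i h.2
  · rintro ⟨l, i⟩ h
    simp only [Finset.mem_filter, Finset.mem_product, mem_arrangements, Finset.mem_range] at h
    obtain ⟨⟨⟨h1, h2⟩, h3⟩, h4⟩ := h
    have hlen : i ≤ l.length := by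
      rw [← h1, Multiset.coe_card] at h3; omega
    simp only [Prod.mk.injEq, and_true]
    rw [List.take_left' (by simp; omega), ← List.drop_drop, List.drop_left' (by simp; omega)]
    simp
  · rintro ⟨l, i⟩ h
    simp only [Finset.mem_filter, Finset.mem_product, mem_arrangements, Finset.mem_range] at h
    obtain ⟨⟨⟨h1, h2⟩, h3⟩, h4⟩ := h
    have hs := hsplit l i h4
    have hlen : i < l.length := (List.getElem?_eq_some_iff.1 h4).1
    rw [← hs, hins] at h1
    have hm := hmem _ h1
    have e1 : pairCount I l =
        pairCount I (l.take i ++ l.drop (i + 1)) + (l.drop (i + 1)).countP (I c) := by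
      rw [← pairCount_insert I c _ _ fun x hx => hbefore x (hm x (List.mem_append_left _ hx)), hs]
    have e2 : (l.take i ++ l.drop (i + 1)).drop i = l.drop (i + 1) :=
      List.drop_left' (by simp; omega)
    dsimp only
    rw [e1, e2, ← hcount _ fun x hx => hm x (List.mem_append_right _ hx), add_assoc]

/-- The mirror image of `genSum_cons`. -/
theorem genSum_cons_mirror (V : List α → Prop) (I : α → α → Bool) (c : α) (p : α → Bool)
    (b : Bool) (C : Multiset α) (hc : I c c = false) (hpc : p c = true)
    (hafter : ∀ x ∈ C, I c x = false) (hbefore : ∀ x ∈ C, x ≠ c → p x = I x c)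
    (hV : ∀ l₁ l₂ : List α, ((l₁ ++ l₂ : List α) : Multiset α) = C →
      (V (l₁ ++ c :: l₂) ↔ V (l₁ ++ l₂) ∧ eligible b p l₂.reverse = true)) :
    qNat (C.count c + 1) * genSum V I (c ::ₘ C) =
      qNat (C.countP (fun x => p x = true) + b.toNat) * genSum V I C := by
  rw [← genSum_reverse V I, ← genSum_reverse V I]
  apply genSum_cons (fun l => V l.reverse) (fun x y => I y x) c p b C hc hpc hafter hbefore
  intro l₁ l₂ h
  have := hV l₂.reverse l₁.reverse (by
    rw [← h, ← List.reverse_append]; exact Multiset.coe_eq_coe.2 (List.reverse_perm _))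
  simpa using this

end Insertion

/-! ### Words of letters with levels -/

/-- Letters are pairs `(d, v)` of a level `d`, counted from the base diagonal, and a label `v`.
`Follows x y` says that `y` may be the letter directly after `x`: the level rises by at most one,
and only together with the label, since two consecutive vertical steps are then in one column. -/
def Follows (x y : ℕ × ℕ) : Prop := y.1 ≤ x.1 ∨ (y.1 = x.1 + 1 ∧ x.2 < y.2)

/-- Words of letters that encode a labelled square path of shift `s`. -/
structure IsWord (s : ℕ) (l : List (ℕ × ℕ)) : Prop where
  chain : l.IsChain Follows
  head : ∀ x ∈ l.head?, x.1 < s ∨ (x.1 = s ∧ x.2 ≠ 0)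
  last : ∀ x ∈ l.getLast?, s ≤ x.1

/-- Primary and secondary inversions between a letter `x` and a later letter `y`. -/
def inv (x y : ℕ × ℕ) : Bool :=
  decide ((x.1 = y.1 ∧ x.2 < y.2) ∨ (x.1 = y.1 + 1 ∧ y.2 < x.2))

theorem isWord_iff (s : ℕ) (l : List (ℕ × ℕ)) : IsWord s l ↔ l.IsChain Follows ∧
    (∀ x ∈ l.head?, x.1 < s ∨ (x.1 = s ∧ x.2 ≠ 0)) ∧ ∀ x ∈ l.getLast?, s ≤ x.1 :=
  ⟨fun h => ⟨h.1, h.2, h.3⟩, fun h => ⟨h.1, h.2.1, h.2.2⟩⟩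

/-- The level `d` with the labels `L`. -/
def levelLetters (d : ℕ) (L : List ℕ) : Multiset (ℕ × ℕ) := (L.map (Prod.mk d) : List (ℕ × ℕ))

theorem levelLetters_cons (d v : ℕ) (L : List ℕ) :
    levelLetters d (v :: L) = (d, v) ::ₘ levelLetters d L := rfl

theorem mem_levelLetters {d : ℕ} {L : List ℕ} {x : ℕ × ℕ} :
    x ∈ levelLetters d L ↔ x.1 = d ∧ x.2 ∈ L := by
  obtain ⟨a, b⟩ := x
  simp only [levelLetters, Multiset.mem_coe, List.mem_map, Prod.mk.injEq]
  constructor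
  · rintro ⟨c, hc, rfl, rfl⟩; exact ⟨rfl, hc⟩
  · rintro ⟨rfl, h⟩; exact ⟨b, h, rfl, rfl⟩

theorem countP_levelLetters (d : ℕ) (L : List ℕ) (p : ℕ × ℕ → Prop) [DecidablePred p] :
    (levelLetters d L).countP p = L.countP fun v => decide (p (d, v)) := by
  simp only [levelLetters, Multiset.coe_countP, List.countP_map]
  rfl

theorem count_levelLetters (d v : ℕ) (L : List ℕ) :
    (levelLetters d L).count (d, v) = L.count v := by
  rw [levelLetters, ← Multiset.map_coe,
    Multiset.count_map_eq_count' _ _ (fun a b h => (Prod.mk.inj h).2), Multiset.coe_count]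

/-! ### Insertion of the letters of the highest and of the lowest level -/

/-- The smallest letter of the highest level can be inserted after the letters of its own level
and after the smaller letters of the level below. -/
theorem isWord_insert_top {s k v : ℕ} (hs : s ≤ k) (l₁ l₂ : List (ℕ × ℕ))
    (hle : ∀ x ∈ l₁ ++ l₂, x.1 ≤ k + 1) (hmin : ∀ x ∈ l₁ ++ l₂, x.1 = k + 1 → v ≤ x.2) :
    IsWord s (l₁ ++ (k + 1, v) :: l₂) ↔ IsWord s (l₁ ++ l₂) ∧
      eligible false (fun x => decide (x.1 = k + 1 ∨ (x.1 = k ∧ x.2 < v))) l₁ = true := by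
  rcases List.eq_nil_or_concat' l₁ with rfl | ⟨l, x, rfl⟩
  · simp only [List.nil_append, eligible_nil, Bool.false_eq_true, and_false, iff_false]
    intro h
    have := h.head (k + 1, v) (by simp)
    simp only at this
    omega
  · rw [eligible_concat, decide_eq_true_eq]
    have hx := hle x (by simp)
    rw [isWord_iff, isWord_iff]
    cases l₂ with
    | nil =>
      have e : l ++ [x] ++ [(k + 1, v)] = l ++ x :: (k + 1, v) :: [] := by simp
      have hh : (l ++ [x] ++ [(k + 1, v)]).head? = (l ++ [x]).head? := by cases l <;> rfl
      rw [hh, e, List.isChain_append_cons_cons]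
      simp only [List.isChain_singleton, and_true, List.append_nil, Follows]
      simp only [List.getLast?_append, List.getLast?_cons_cons, List.getLast?_singleton,
        Option.some_or, Option.mem_def, Option.some.injEq, forall_eq']
      constructor
      · rintro ⟨⟨h1, h2⟩, h3, h4⟩
        exact ⟨⟨h1, h3, by omega⟩, by omega⟩
      · rintro ⟨⟨h1, h2, h3⟩, h4⟩
        exact ⟨⟨h1, by omega⟩, h2, by omega⟩
    | cons y l' =>
      have hy := hle y (by simp)
      have hy' := hmin y (by simp)
      have e : l ++ [x] ++ (k + 1, v) :: y :: l' = l ++ x :: (k + 1, v) :: y :: l' := by simp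
      have e' : l ++ [x] ++ y :: l' = l ++ x :: y :: l' := by simp
      have hh : (l ++ x :: (k + 1, v) :: y :: l').head? = (l ++ x :: y :: l').head? := by
        cases l <;> rfl
      have hl : (l ++ x :: (k + 1, v) :: y :: l').getLast? = (l ++ x :: y :: l').getLast? := by
        simp [List.getLast?_append]
      rw [e, e', hh, hl, List.isChain_append_cons_cons, List.isChain_append_cons_cons,
        List.isChain_cons_cons]
      simp only [Follows]
      constructor
      · rintro ⟨⟨h1, h2, h3, h4⟩, h5, h6⟩
        exact ⟨⟨⟨h1, by omega, h4⟩, h5, h6⟩, by omega⟩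
      · rintro ⟨⟨⟨h1, h2, h3⟩, h4, h5⟩, h6⟩
        exact ⟨⟨h1, by omega, by omega, h3⟩, h4, h5⟩

/-- The largest letter of the lowest level can be inserted before the letters of its own level and
before the larger letters of the level above. -/
theorem isWord_insert_bot {s a v : ℕ} (hs : a < s) (l₁ l₂ : List (ℕ × ℕ))
    (hle : ∀ x ∈ l₁ ++ l₂, a ≤ x.1) (hmax : ∀ x ∈ l₁ ++ l₂, x.1 = a → x.2 ≤ v) :
    IsWord s (l₁ ++ (a, v) :: l₂) ↔ IsWord s (l₁ ++ l₂) ∧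
      eligible false (fun y => decide (y.1 = a ∨ (y.1 = a + 1 ∧ v < y.2))) l₂.reverse = true := by
  cases l₂ with
  | nil =>
    simp only [List.reverse_nil, eligible_nil, Bool.false_eq_true, and_false, iff_false]
    intro h
    have := h.last (a, v) (by simp)
    simp only at this
    omega
  | cons y l' =>
    rw [List.reverse_cons, eligible_concat, decide_eq_true_eq]
    have hy := hle y (by simp)
    rw [isWord_iff, isWord_iff]
    rcases List.eq_nil_or_concat' l₁ with rfl | ⟨l, x, rfl⟩
    · simp only [List.nil_append, List.isChain_cons_cons, List.head?_cons, List.getLast?_cons_cons,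
        Option.mem_def, Option.some.injEq, forall_eq', Follows]
      constructor
      · rintro ⟨⟨h1, h2⟩, h3, h4⟩
        exact ⟨⟨h2, by omega, h4⟩, by omega⟩
      · rintro ⟨⟨h1, h2, h3⟩, h4⟩
        exact ⟨⟨by omega, h1⟩, by omega, h3⟩
    · have hx := hle x (by simp)
      have hx' := hmax x (by simp)
      have e : l ++ [x] ++ (a, v) :: y :: l' = l ++ x :: (a, v) :: y :: l' := by simp
      have e' : l ++ [x] ++ y :: l' = l ++ x :: y :: l' := by simp
      have hh : (l ++ x :: (a, v) :: y :: l').head? = (l ++ x :: y :: l').head? := by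
        cases l <;> rfl
      have hl : (l ++ x :: (a, v) :: y :: l').getLast? = (l ++ x :: y :: l').getLast? := by
        simp [List.getLast?_append]
      rw [e, e', hh, hl, List.isChain_append_cons_cons, List.isChain_append_cons_cons,
        List.isChain_cons_cons]
      simp only [Follows]
      constructor
      · rintro ⟨⟨h1, h2, h3, h4⟩, h5, h6⟩
        exact ⟨⟨⟨h1, by omega, h4⟩, h5, h6⟩, by omega⟩
      · rintro ⟨⟨⟨h1, h2, h3⟩, h4, h5⟩, h6⟩
        exact ⟨⟨h1, by omega, by omega, h3⟩, h4, h5⟩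

/-- The product of the `q`-factorials of the multiplicities of the letters of a list. -/
noncomputable def multFactorial : List ℕ → Qqt
  | [] => 1
  | v :: l => qNat (l.count v + 1) * multFactorial l

/-- The product of the numbers of places, as `q`-integers, for the successive insertion of the
letters of a level, from last to first, when `f v` letters of the adjacent level admit `v`. -/
noncomputable def placesProd (f : ℕ → ℕ) : List ℕ → Qqt
  | [] => 1
  | v :: l => qNat (f v + l.length) * placesProd f l

theorem placesProd_congr {f g : ℕ → ℕ} {L : List ℕ} (h : ∀ v ∈ L, f v = g v) :
    placesProd f L = placesProd g L := by
  induction L with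
  | nil => rfl
  | cons v L ih =>
    rw [placesProd, placesProd, h v List.mem_cons_self,
      ih fun w hw => h w (List.mem_cons_of_mem _ hw)]

theorem multFactorial_perm {l l' : List ℕ} (h : l.Perm l') :
    multFactorial l = multFactorial l' := by
  induction h with
  | nil => rfl
  | cons x h ih => rw [multFactorial, multFactorial, ih, h.count_eq]
  | swap x y l =>
    by_cases hxy : x = y
    · rw [hxy]
    · simp only [multFactorial, List.count_cons_of_ne hxy, List.count_cons_of_ne (Ne.symm hxy)]
      ring
  | trans _ _ ih ih' => rw [ih, ih']

/-- The generating function of the words of shift `s` with the letters `C`. -/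
noncomputable def wordSum (s : ℕ) (C : Multiset (ℕ × ℕ)) : Qqt := genSum (IsWord s) inv C

theorem mem_of_coe_eq {α : Type*} {l : List α} {C : Multiset α} (h : (l : Multiset α) = C) {x : α}
    (hx : x ∈ l) : x ∈ C := by
  rw [← h]; exact hx

theorem wordSum_add_top {s k : ℕ} (hs : s ≤ k) (C : Multiset (ℕ × ℕ)) (hC : ∀ x ∈ C, x.1 ≤ k)
    (L : List ℕ) (hL : L.Pairwise (· ≤ ·)) :
    wordSum s (C + levelLetters (k + 1) L) * multFactorial L =
      placesProd (fun v => C.countP fun x => x.1 = k ∧ x.2 < v) L * wordSum s C := by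
  induction L with
  | nil => simp [levelLetters, multFactorial, placesProd]
  | cons v L ih =>
    rw [List.pairwise_cons] at hL
    have key := genSum_cons (IsWord s) inv (k + 1, v)
      (fun x => decide (x.1 = k + 1 ∨ (x.1 = k ∧ x.2 < v))) false (C + levelLetters (k + 1) L)
      (by simp [inv]) (by simp)
      (by
        intro x hx
        rw [Multiset.mem_add, mem_levelLetters] at hx
        simp only [inv, decide_eq_false_iff_not]
        rcases hx with hx | hx
        · have := hC x hx; omega
        · have := hL.1 _ hx.2; omega)
      (by
        rintro ⟨d, w⟩ hx hne
        rw [Multiset.mem_add, mem_levelLetters] at hx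
        simp only [inv, decide_eq_decide]
        simp only [ne_eq, Prod.mk.injEq, not_and] at hne hx ⊢
        rcases hx with hx | hx
        · have := hC _ hx
          simp only at this
          omega
        · have := hL.1 _ hx.2; omega)
      (by
        intro l₁ l₂ h
        apply isWord_insert_top hs
        · intro x hx
          have := mem_of_coe_eq h hx
          rw [Multiset.mem_add, mem_levelLetters] at this
          rcases this with hx | hx
          · have := hC _ hx; omega
          · omega
        · intro x hx h1
          have := mem_of_coe_eq h hx
          rw [Multiset.mem_add, mem_levelLetters] at this
          rcases this with hx | hx
          · have := hC _ hx; omega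
          · exact hL.1 _ hx.2)
    have hcount : (C + levelLetters (k + 1) L).count (k + 1, v) = L.count v := by
      rw [Multiset.count_add, count_levelLetters, Multiset.count_eq_zero_of_notMem, zero_add]
      intro h
      have := hC _ h
      simp only at this
      omega
    have hcountP : (C + levelLetters (k + 1) L).countP
        (fun x => decide (x.1 = k + 1 ∨ (x.1 = k ∧ x.2 < v)) = true) =
        (C.countP fun x => x.1 = k ∧ x.2 < v) + L.length := by
      rw [Multiset.countP_add, countP_levelLetters]
      congr 1
      · apply Multiset.countP_congr rfl
        intro x hx
        have := hC x hx
        simp only [decide_eq_true_eq, eq_iff_iff]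
        omega
      · simp
    rw [hcount, hcountP] at key
    simp only [Bool.toNat_false, add_zero] at key
    rw [levelLetters_cons, Multiset.add_cons, multFactorial, placesProd]
    simp only [wordSum] at ih ⊢
    linear_combination multFactorial L * key +
      qNat ((C.countP fun x => x.1 = k ∧ x.2 < v) + L.length) * ih hL.2

theorem wordSum_add_bot {s a : ℕ} (hs : a < s) (C : Multiset (ℕ × ℕ)) (hC : ∀ x ∈ C, a < x.1)
    (L : List ℕ) (hL : L.Pairwise (· ≥ ·)) :
    wordSum s (C + levelLetters a L) * multFactorial L =
      placesProd (fun v => C.countP fun x => x.1 = a + 1 ∧ v < x.2) L * wordSum s C := by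
  induction L with
  | nil => simp [levelLetters, multFactorial, placesProd]
  | cons v L ih =>
    rw [List.pairwise_cons] at hL
    have key := genSum_cons_mirror (IsWord s) inv (a, v)
      (fun x => decide (x.1 = a ∨ (x.1 = a + 1 ∧ v < x.2))) false (C + levelLetters a L)
      (by simp [inv]) (by simp)
      (by
        intro x hx
        rw [Multiset.mem_add, mem_levelLetters] at hx
        simp only [inv, decide_eq_false_iff_not]
        rcases hx with hx | hx
        · have := hC x hx; omega
        · have := hL.1 _ hx.2; omega)
      (by
        rintro ⟨d, w⟩ hx hne
        rw [Multiset.mem_add, mem_levelLetters] at hx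
        simp only [inv, decide_eq_decide]
        simp only [ne_eq, Prod.mk.injEq, not_and] at hne hx ⊢
        rcases hx with hx | hx
        · have := hC _ hx
          simp only at this
          omega
        · have := hL.1 _ hx.2; omega)
      (by
        intro l₁ l₂ h
        apply isWord_insert_bot hs
        · intro x hx
          have := mem_of_coe_eq h hx
          rw [Multiset.mem_add, mem_levelLetters] at this
          rcases this with hx | hx
          · have := hC _ hx; omega
          · omega
        · intro x hx h1
          have := mem_of_coe_eq h hx
          rw [Multiset.mem_add, mem_levelLetters] at this
          rcases this with hx | hx
          · have := hC _ hx; omega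
          · exact hL.1 _ hx.2)
    have hcount : (C + levelLetters a L).count (a, v) = L.count v := by
      rw [Multiset.count_add, count_levelLetters, Multiset.count_eq_zero_of_notMem, zero_add]
      intro h
      have := hC _ h
      simp only at this
      omega
    have hcountP : (C + levelLetters a L).countP
        (fun x => decide (x.1 = a ∨ (x.1 = a + 1 ∧ v < x.2)) = true) =
        (C.countP fun x => x.1 = a + 1 ∧ v < x.2) + L.length := by
      rw [Multiset.countP_add, countP_levelLetters]
      congr 1
      · apply Multiset.countP_congr rfl
        intro x hx
        have := hC x hx
        simp only [decide_eq_true_eq, eq_iff_iff]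
        omega
      · simp
    rw [hcount, hcountP] at key
    simp only [Bool.toNat_false, add_zero] at key
    rw [levelLetters_cons, Multiset.add_cons, multFactorial, placesProd]
    simp only [wordSum] at ih ⊢
    linear_combination multFactorial L * key +
      qNat ((C.countP fun x => x.1 = a + 1 ∧ v < x.2) + L.length) * ih hL.2

/-! ### Words on a single level -/

theorem isWord_of_level {s : ℕ} {l : List (ℕ × ℕ)} (h : ∀ x ∈ l, x.1 = s) :
    IsWord s l ↔ ∀ x ∈ l.head?, x.2 ≠ 0 := by
  rw [isWord_iff]
  constructor
  · rintro ⟨_, h1, _⟩ x hx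
    have := h x (List.mem_of_mem_head? hx)
    have := h1 x hx
    omega
  · intro h1
    refine ⟨List.Pairwise.isChain ?_, fun x hx => ?_, fun x hx => ?_⟩
    · apply List.pairwise_of_forall_mem_list
      intro x hx y hy
      left
      rw [h x hx, h y hy]
    · exact Or.inr ⟨h x (List.mem_of_mem_head? hx), h1 x hx⟩
    · rw [h x (List.mem_of_getLast? hx)]

/-- The `q`-factorial. -/
noncomputable def qFactorial (k : ℕ) : Qqt := ∏ i ∈ Finset.range k, qNat (i + 1)

theorem qFactorial_succ (k : ℕ) : qFactorial (k + 1) = qFactorial k * qNat (k + 1) :=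
  Finset.prod_range_succ _ _

/-- Insertion of the smallest letter on a single level; `b` says whether it may come first. -/
theorem genSum_cons_level (s v : ℕ) (L : List ℕ) (hL : ∀ w ∈ L, v ≤ w) (b : Bool)
    (hb : ∀ l₁ l₂ : List (ℕ × ℕ), ((l₁ ++ l₂ : List _) : Multiset _) = levelLetters s L →
      (IsWord s (l₁ ++ (s, v) :: l₂) ↔
        IsWord s (l₁ ++ l₂) ∧ eligible b (fun _ => true) l₁ = true)) :
    wordSum s (levelLetters s (v :: L)) * multFactorial (v :: L) =
      qNat (L.length + b.toNat) * (wordSum s (levelLetters s L) * multFactorial L) := by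
  have key := genSum_cons (IsWord s) inv (s, v) (fun _ => true) b (levelLetters s L)
    (by simp [inv]) rfl
    (by
      rintro ⟨d, w⟩ hx
      rw [mem_levelLetters] at hx
      have := hL _ hx.2
      simp only [inv, decide_eq_false_iff_not] at this ⊢
      omega)
    (by
      rintro ⟨d, w⟩ hx hne
      rw [mem_levelLetters] at hx
      have := hL _ hx.2
      simp only [inv, ne_eq, Prod.mk.injEq, not_and, eq_comm (a := true),
        decide_eq_true_eq] at this hx hne ⊢
      omega) hb
  rw [count_levelLetters, countP_levelLetters] at key
  simp only [decide_true, List.countP_true] at key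
  rw [levelLetters_cons, multFactorial]
  simp only [wordSum]
  linear_combination multFactorial L * key

theorem wordSum_level_nonzero (s : ℕ) (L : List ℕ) (hL : L.Pairwise (· ≤ ·))
    (h0 : ∀ v ∈ L, v ≠ 0) :
    wordSum s (levelLetters s L) * multFactorial L = qFactorial L.length := by
  induction L with
  | nil =>
    have h1 : arrangements (levelLetters s []) = {[]} := by
      ext l
      simp [mem_arrangements, levelLetters]
    have h2 : IsWord s [] := by simp [isWord_iff]
    simp [wordSum, genSum, h1, h2, Finset.filter_singleton, pairCount, multFactorial, qFactorial]
  | cons v L ih =>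
    rw [List.pairwise_cons] at hL
    rw [genSum_cons_level s v L hL.1 true,
      ih hL.2 fun w hw => h0 w (List.mem_cons_of_mem _ hw), List.length_cons, qFactorial_succ]
    · exact mul_comm _ _
    · intro l₁ l₂ h
      have hm : ∀ x ∈ l₁ ++ l₂, x.1 = s ∧ x.2 ≠ 0 := by
        intro x hx
        have := mem_of_coe_eq h hx
        rw [mem_levelLetters] at this
        exact ⟨this.1, h0 _ (List.mem_cons_of_mem _ this.2)⟩
      have hm' : ∀ x ∈ l₁ ++ (s, v) :: l₂, x.1 = s ∧ x.2 ≠ 0 := by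
        intro x hx
        simp only [List.mem_append, List.mem_cons] at hx hm
        rcases hx with hx | rfl | hx
        · exact hm x (Or.inl hx)
        · exact ⟨rfl, h0 v List.mem_cons_self⟩
        · exact hm x (Or.inr hx)
      have he : eligible true (fun _ : ℕ × ℕ => true) l₁ = true := by
        rcases List.eq_nil_or_concat' l₁ with rfl | ⟨l, x, rfl⟩
        · rfl
        · rw [eligible_concat]
      rw [isWord_of_level fun x hx => (hm' x hx).1, isWord_of_level fun x hx => (hm x hx).1]
      exact ⟨fun _ => ⟨fun x hx => (hm x (List.mem_of_mem_head? hx)).2, he⟩,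
        fun _ x hx => (hm' x (List.mem_of_mem_head? hx)).2⟩

/-- On a single level only the first letter is constrained, to be nonzero. -/
theorem wordSum_level (s : ℕ) (L : List ℕ) (hL : L.Pairwise (· ≤ ·)) (hne : L ≠ []) :
    wordSum s (levelLetters s L) * multFactorial L =
      qNat (L.countP fun v => v ≠ 0) * qFactorial (L.length - 1) := by
  induction L with
  | nil => exact absurd rfl hne
  | cons v L ih =>
    by_cases hv : v = 0
    · subst hv
      rw [List.pairwise_cons] at hL
      rw [genSum_cons_level s 0 L hL.1 false]
      · rcases L.eq_nil_or_concat' with rfl | hcon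
        · simp [qNat]
        · have hL0 : L ≠ [] := by rintro rfl; simp at hcon
          obtain ⟨k, hk⟩ : ∃ k, L.length = k + 1 :=
            Nat.exists_eq_succ_of_ne_zero (by simpa using hL0)
          rw [ih hL.2 hL0]
          simp only [List.length_cons, hk, Nat.add_sub_cancel, qFactorial_succ, Bool.toNat_false,
            add_zero]
          simp only [ne_eq, decide_not, List.countP_cons, decide_true, Bool.not_true,
            Bool.false_eq_true, if_false, add_zero]
          ring
      · intro l₁ l₂ h
        have hm : ∀ x ∈ l₁ ++ l₂, x.1 = s := fun x hx =>
          (mem_levelLetters.1 (mem_of_coe_eq h hx)).1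
        have hm' : ∀ x ∈ l₁ ++ (s, 0) :: l₂, x.1 = s := by
          intro x hx
          simp only [List.mem_append, List.mem_cons] at hx hm
          rcases hx with hx | rfl | hx
          · exact hm x (Or.inl hx)
          · rfl
          · exact hm x (Or.inr hx)
        rw [isWord_of_level hm', isWord_of_level hm]
        cases l₁ with
        | nil => simp [eligible_nil]
        | cons x l =>
          have he : eligible false (fun _ : ℕ × ℕ => true) (x :: l) = true := by
            rw [eligible_cons]
            rcases List.eq_nil_or_concat' l with rfl | ⟨l, x, rfl⟩
            · rfl
            · rw [eligible_concat]
          simp [he]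
    · have h0 : ∀ w ∈ v :: L, w ≠ 0 := by
        intro w hw
        rcases List.mem_cons.1 hw with rfl | hw
        · exact hv
        · have := (List.pairwise_cons.1 hL).1 w hw; omega
      rw [wordSum_level_nonzero s _ hL h0]
      have : (v :: L).countP (fun v => decide (v ≠ 0)) = (v :: L).length := by
        rw [List.countP_eq_length]
        simpa using h0
      rw [this, List.length_cons, Nat.add_sub_cancel, qFactorial_succ, mul_comm]

/-! ### Independence of the shift -/

/-- Merging the sorted levels `xs` and `ys` into one sorted word, with `i` further letters of the
lower level below them, describes a lattice path whose up and down steps are recorded by the two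
products; it uses each edge equally often in both directions, except those between its ends. -/
theorem placesProd_comparison (i : ℕ) (xs ys : List ℕ) (hx : xs.Pairwise (· ≤ ·))
    (hy : ys.Pairwise (· ≤ ·)) (h1 : 1 ≤ i + xs.length) (h2 : 1 ≤ i + ys.length) :
    placesProd (fun v => i + xs.countP fun w => w < v) ys * qFactorial (i + xs.length - 1) =
      (∏ j : Fin xs.length, qNat ((ys.countP fun w => xs[j] < w) + (i + j))) *
        qFactorial (i + ys.length - 1) := by
  induction hn : xs.length + ys.length using Nat.strong_induction_on generalizing i xs ys with
  | _ n ih =>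
  subst hn
  -- removal of the smallest letter, from the upper level in case of a tie
  by_cases hcase : ∃ x xs', xs = x :: xs' ∧ ∀ y ∈ ys, x < y
  · obtain ⟨x, xs', rfl, hlt⟩ := hcase
    rw [List.pairwise_cons] at hx
    have h := ih (xs'.length + ys.length) (by simp) (i + 1) xs' ys hx.2 hy
      (by omega) (by omega) rfl
    have e1 : placesProd (fun v => i + (x :: xs').countP fun w => w < v) ys =
        placesProd (fun v => i + 1 + xs'.countP fun w => w < v) ys := by
      apply placesProd_congr
      intro v hv
      simp [hlt v hv]
      ring
    have e2 : (ys.countP fun w => decide (x < w)) = ys.length := by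
      rw [List.countP_eq_length]
      simpa using hlt
    obtain ⟨k, hk⟩ : ∃ k, i + ys.length = k + 1 := ⟨i + ys.length - 1, by omega⟩
    have e3 : i + 1 + ys.length - 1 = k + 1 := by omega
    have e4 : i + 1 + xs'.length - 1 = i + (x :: xs').length - 1 := by
      rw [List.length_cons]; omega
    rw [e3, e4, qFactorial_succ] at h
    have e5 : i + ys.length - 1 = k := by omega
    have e6 : ys.length + i = k + 1 := by omega
    have e7 : (∏ j : Fin (x :: xs').length,
        qNat ((ys.countP fun w => decide ((x :: xs')[j] < w)) + (i + j))) =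
        qNat ((ys.countP fun w => decide (x < w)) + (i + 0)) *
          ∏ j : Fin xs'.length,
            qNat ((ys.countP fun w => decide (xs'[j] < w)) + (i + (j + 1))) :=
      Fin.prod_univ_succ _
    have e8 : ∀ j : Fin xs'.length, i + 1 + (j : ℕ) = i + (j + 1) := fun j => by ring
    rw [e1, h, e5, e7, e2, add_zero, e6]
    simp only [e8]
    ring
  · cases ys with
    | nil =>
      cases xs with
      | nil => simp [placesProd]
      | cons x xs' => exact absurd ⟨x, xs', rfl, by simp⟩ hcase
    | cons y ys =>
      rw [List.pairwise_cons] at hy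
      have hyx : ∀ x ∈ xs, y ≤ x := by
        cases xs with
        | nil => simp
        | cons x xs' =>
          have : y ≤ x := by
            by_contra hlt
            refine hcase ⟨x, xs', rfl, fun z hz => ?_⟩
            rcases List.mem_cons.1 hz with rfl | hz
            · omega
            · have := hy.1 z hz; omega
          intro z hz
          rcases List.mem_cons.1 hz with rfl | hz
          · exact this
          · exact this.trans ((List.pairwise_cons.1 hx).1 z hz)
      have e1 : (xs.countP fun w => decide (w < y)) = 0 := by
        rw [List.countP_eq_zero]
        intro z hz
        have := hyx z hz
        simpa using this
      have e2 : ∀ j : Fin xs.length, ((y :: ys).countP fun w => decide (xs[j] < w)) =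
          ys.countP fun w => decide (xs[j] < w) := by
        intro j
        have := hyx xs[j] (List.getElem_mem _)
        rw [List.countP_cons_of_neg]
        simpa using this
      rw [placesProd, e1]
      simp only [e2, add_zero, List.length_cons]
      by_cases h0 : i + ys.length = 0
      · -- the path reaches zero, so that both products vanish
        have hi : i = 0 := by omega
        have hys : ys = [] := List.eq_nil_of_length_eq_zero (by omega)
        subst hi hys
        have hxs : 0 < xs.length := by omega
        have : (∏ j : Fin xs.length, qNat ((([] : List ℕ).countP fun w => xs[j] < w) + (0 + j)))
            = 0 := Finset.prod_eq_zero (Finset.mem_univ ⟨0, hxs⟩) (by simp [qNat])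
        rw [this]
        simp [qNat]
      · obtain ⟨k, hk⟩ : ∃ k, i + ys.length = k + 1 := ⟨i + ys.length - 1, by omega⟩
        have h := ih (xs.length + ys.length) (by simp) i xs ys hx hy.2 h1 (by omega) rfl
        have e3 : i + ys.length - 1 = k := by omega
        have e4 : i + (ys.length + 1) - 1 = k + 1 := by omega
        rw [e3] at h
        rw [e4, qFactorial_succ, mul_assoc, h, hk]
        ring

theorem placesProd_reverse (f : ℕ → ℕ) (L : List ℕ) :
    placesProd f L.reverse = ∏ j : Fin L.length, qNat (f L[j] + j) := by
  induction L using List.reverseRecOn with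
  | nil => simp [placesProd]
  | append_singleton L v ih =>
    rw [List.reverse_append, List.reverse_singleton, List.singleton_append, placesProd, ih]
    rw [← Fin.prod_congr' _ (by simp : L.length + 1 = (L ++ [v]).length), Fin.prod_univ_castSucc]
    simp [mul_comm]

section Levels

variable (X : ℕ → List ℕ)

/-- The letters of the levels `a, …, b - 1`. -/
noncomputable def content (a b : ℕ) : Multiset (ℕ × ℕ) :=
  ∑ d ∈ Finset.Ico a b, levelLetters d (X d)

theorem level_mem_content {a b : ℕ} {x : ℕ × ℕ} (hx : x ∈ content X a b) : a ≤ x.1 ∧ x.1 < b := by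
  rw [content, Multiset.mem_sum] at hx
  obtain ⟨d, hd, hx⟩ := hx
  rw [(mem_levelLetters.1 hx).1]
  exact Finset.mem_Ico.1 hd

theorem countP_content {a b d : ℕ} (hd : a ≤ d ∧ d < b) (p : ℕ → Prop) [DecidablePred p] :
    ((content X a b).countP fun x => x.1 = d ∧ p x.2) = (X d).countP fun v => decide (p v) := by
  rw [content, ← Multiset.coe_countPAddMonoidHom, map_sum,
    Finset.sum_eq_single_of_mem d (Finset.mem_Ico.2 hd)]
  · rw [Multiset.coe_countPAddMonoidHom, countP_levelLetters]
    simp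
  · intro c _ hc
    rw [Multiset.coe_countPAddMonoidHom, Multiset.countP_eq_zero]
    intro x hx h
    exact hc (by rw [← (mem_levelLetters.1 hx).1, h.1])

/-- The number of places for the insertion of level `d + 1` above level `d`. -/
noncomputable def placesUp (d : ℕ) : Qqt :=
  placesProd (fun v => (X d).countP fun w => w < v) (X (d + 1))

/-- The number of places for the insertion of level `d` below level `d + 1`. -/
noncomputable def placesDown (d : ℕ) : Qqt :=
  placesProd (fun v => (X (d + 1)).countP fun w => v < w) (X d).reverse

variable {X}

theorem placesUp_mul_qFactorial {d : ℕ} (hd : (X d).Pairwise (· ≤ ·)) (hd0 : X d ≠ [])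
    (hd' : (X (d + 1)).Pairwise (· ≤ ·)) (hd0' : X (d + 1) ≠ []) :
    placesUp X d * qFactorial ((X d).length - 1) =
      placesDown X d * qFactorial ((X (d + 1)).length - 1) := by
  have h := placesProd_comparison 0 (X d) (X (d + 1)) hd hd'
    (by have := List.length_pos_iff.2 hd0; omega) (by have := List.length_pos_iff.2 hd0'; omega)
  simp only [zero_add] at h
  rw [placesUp, placesDown, placesProd_reverse, h]

/-- The product formula for words with the levels `a, …, b - 1`: the level `s` is arranged first,
the levels above it are inserted upwards, the levels below it downwards. -/
theorem wordSum_content {s a b : ℕ} (has : a ≤ s) (hsb : s < b)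
    (hX : ∀ d, d < b → (X d).Pairwise (· ≤ ·)) (hs : X s ≠ []) :
    wordSum s (content X a b) * ∏ d ∈ Finset.Ico a b, multFactorial (X d) =
      qNat ((X s).countP fun v => v ≠ 0) * (qFactorial ((X s).length - 1) *
        (∏ d ∈ Finset.Ico a s, placesDown X d) * ∏ d ∈ Finset.Ico s (b - 1), placesUp X d) := by
  have up : wordSum s (content X s b) * ∏ d ∈ Finset.Ico s b, multFactorial (X d) =
      qNat ((X s).countP fun v => v ≠ 0) * (qFactorial ((X s).length - 1) *
        ∏ d ∈ Finset.Ico s (b - 1), placesUp X d) := by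
    induction b, (show s + 1 ≤ b from hsb) using Nat.le_induction with
    | base =>
      have := wordSum_level s (X s) (hX s (by omega)) hs
      simpa [content] using this
    | succ b hb ih =>
      obtain ⟨c, rfl⟩ : ∃ c, b = c + 1 := ⟨b - 1, by omega⟩
      have ih := ih (by omega) fun d hd => hX d (by omega)
      have h := wordSum_add_top (s := s) (k := c) (by omega) (content X s (c + 1))
        (fun x hx => by have := level_mem_content X hx; omega) (X (c + 1)) (hX (c + 1) (by omega))
      have e : (fun v => (content X s (c + 1)).countP fun x => x.1 = c ∧ x.2 < v) =
          fun v => (X c).countP fun w => decide (w < v) := by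
        funext v
        exact countP_content X ⟨by omega, by omega⟩ fun w => w < v
      rw [e] at h
      have e' : content X s (c + 1 + 1) =
          content X s (c + 1) + levelLetters (c + 1) (X (c + 1)) := by
        rw [content, Finset.sum_Ico_succ_top (by omega)]
        rfl
      rw [e', Finset.prod_Ico_succ_top (by omega : s ≤ c + 1), Nat.add_sub_cancel,
        Finset.prod_Ico_succ_top (by omega : s ≤ c) (placesUp X), placesUp]
      rw [Nat.add_sub_cancel] at ih
      linear_combination (∏ d ∈ Finset.Ico s (c + 1), multFactorial (X d)) * h +
        placesProd (fun v => (X c).countP fun w => decide (w < v)) (X (c + 1)) * ih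
  induction has using Nat.decreasingInduction with
  | self => simpa using up
  | of_succ a has ih =>
    have h := wordSum_add_bot (s := s) (a := a) (by omega) (content X (a + 1) b)
      (fun x hx => by have := level_mem_content X hx; omega) (X a).reverse
      (by rw [List.pairwise_reverse]; exact hX a (by omega))
    have e : (fun v => (content X (a + 1) b).countP fun x => x.1 = a + 1 ∧ v < x.2) =
        fun v => (X (a + 1)).countP fun w => decide (v < w) := by
      funext v
      exact countP_content X ⟨by omega, by omega⟩ fun w => v < w
    have e1 : levelLetters a (X a).reverse = levelLetters a (X a) := by
      rw [levelLetters, List.map_reverse]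
      exact Multiset.coe_eq_coe.2 (List.reverse_perm _)
    rw [e, e1, multFactorial_perm (List.reverse_perm _)] at h
    have e' : content X a b = content X (a + 1) b + levelLetters a (X a) := by
      rw [content, Finset.sum_eq_sum_Ico_succ_bot (by omega), add_comm]
      rfl
    rw [e', Finset.prod_eq_prod_Ico_succ_bot (by omega : a < b),
      Finset.prod_eq_prod_Ico_succ_bot (by omega : a < s), placesDown]
    linear_combination (∏ d ∈ Finset.Ico (a + 1) b, multFactorial (X d)) * h +
      placesProd (fun v => (X (a + 1)).countP fun w => decide (v < w)) (X a).reverse * ih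

/-- The shift enters the generating function of the words with given letters only through the
number of nonzero letters of the level `s`. -/
theorem exists_wordSum_content (b : ℕ) (hX : ∀ d, d < b → (X d).Pairwise (· ≤ ·))
    (hne : ∀ d, d < b → X d ≠ []) :
    ∃ E : Qqt, ∀ s, s < b →
      wordSum s (content X 0 b) * ∏ d ∈ Finset.Ico 0 b, multFactorial (X d) =
        qNat ((X s).countP fun v => v ≠ 0) * E := by
  refine ⟨qFactorial ((X 0).length - 1) * (∏ d ∈ Finset.Ico 0 0, placesDown X d) *
    ∏ d ∈ Finset.Ico 0 (b - 1), placesUp X d, fun s hs => ?_⟩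
  rw [wordSum_content (Nat.zero_le s) hs hX (hne s hs)]
  congr 1
  induction s with
  | zero => rfl
  | succ s ih =>
    rw [← ih (by omega), Finset.prod_Ico_succ_top (Nat.zero_le s),
      Finset.prod_eq_prod_Ico_succ_bot (by omega : s < b - 1)]
    linear_combination -(∏ d ∈ Finset.Ico 0 s, placesDown X d) *
      (∏ d ∈ Finset.Ico (s + 1) (b - 1), placesUp X d) *
        placesUp_mul_qFactorial (hX s (by omega)) (hne s (by omega)) (hX (s + 1) hs)
          (hne (s + 1) hs)

end Levels

/-! ### Square paths and the columns of their vertical steps -/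

theorem columnsFrom_replicate_east (x k : ℕ) (p : List Step) :
    columnsFrom x (List.replicate k Step.east ++ p) = columnsFrom (x + k) p := by
  induction k generalizing x with
  | zero => rfl
  | succ k ih =>
    rw [List.replicate_succ, List.cons_append, columnsFrom, ih, add_assoc, add_comm 1]

theorem le_of_mem_columnsFrom {x c : ℕ} {p : List Step} (h : c ∈ columnsFrom x p) : x ≤ c := by
  induction p generalizing x with
  | nil => simp [columnsFrom] at h
  | cons s p ih =>
    cases s with
    | north =>
      rcases List.mem_cons.1 h with rfl | h
      · rfl
      · exact ih h
    | east => exact (Nat.le_succ x).trans (ih h)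

theorem pairwise_columnsFrom (x : ℕ) (p : List Step) : (columnsFrom x p).Pairwise (· ≤ ·) := by
  induction p generalizing x with
  | nil => exact List.Pairwise.nil
  | cons s p ih =>
    cases s with
    | north => exact List.pairwise_cons.2 ⟨fun c hc => le_of_mem_columnsFrom hc, ih x⟩
    | east => exact ih (x + 1)

theorem lt_of_mem_columnsFrom {x c : ℕ} {p : List Step} (hp : p.getLast? = some Step.east)
    (h : c ∈ columnsFrom x p) : c < x + p.count Step.east := by
  induction p generalizing x with
  | nil => simp at hp
  | cons s p ih =>
    cases s with
    | north =>
      have hne : p ≠ [] := by rintro rfl; simp at hp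
      have hp' : p.getLast? = some Step.east := by
        obtain ⟨a, p, rfl⟩ := List.exists_cons_of_ne_nil hne
        simpa using hp
      have hmem : 0 < p.count Step.east :=
        List.count_pos_iff.2 (List.mem_of_getLast? hp')
      have hc : (Step.north :: p).count Step.east = p.count Step.east := by simp
      rcases List.mem_cons.1 h with rfl | h
      · omega
      · have := ih hp' h; omega
    | east =>
      have hne : p ≠ [] := by rintro rfl; simp [columnsFrom] at h
      have hp' : p.getLast? = some Step.east := by
        obtain ⟨a, p, rfl⟩ := List.exists_cons_of_ne_nil hne
        simpa using hp
      have := ih hp' h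
      have hc : (Step.east :: p).count Step.east = p.count Step.east + 1 := by simp
      omega

/-- The steps of the path from the `x`-coordinate `x` to `N` whose vertical steps are in the
given columns. -/
def buildSteps (N : ℕ) : ℕ → List ℕ → List Step
  | x, [] => List.replicate (N - x) Step.east
  | x, c :: cs => List.replicate (c - x) Step.east ++ Step.north :: buildSteps N c cs

theorem columnsFrom_buildSteps (N x : ℕ) (cs : List ℕ) (h : (x :: cs).Pairwise (· ≤ ·)) :
    columnsFrom x (buildSteps N x cs) = cs := by
  induction cs generalizing x with
  | nil =>
    have := columnsFrom_replicate_east x (N - x) []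
    simpa [buildSteps, columnsFrom] using this
  | cons c cs ih =>
    rw [List.pairwise_cons] at h
    have hc := h.1 c List.mem_cons_self
    rw [buildSteps, columnsFrom_replicate_east, Nat.add_sub_cancel' hc, columnsFrom, ih c h.2]

theorem count_east_buildSteps (N x : ℕ) (cs : List ℕ) (h : (x :: cs).Pairwise (· ≤ ·))
    (hN : ∀ c ∈ x :: cs, c ≤ N) : (buildSteps N x cs).count Step.east = N - x := by
  induction cs generalizing x with
  | nil => simp [buildSteps]
  | cons c cs ih =>
    rw [List.pairwise_cons] at h
    have hc := h.1 c List.mem_cons_self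
    have hcN := hN c (by simp)
    have := ih c h.2 fun d hd => hN d (List.mem_cons_of_mem _ hd)
    simp [buildSteps, this]
    omega

theorem getLast?_buildSteps (N x : ℕ) (cs : List ℕ) (hN : ∀ c ∈ x :: cs, c < N) :
    (buildSteps N x cs).getLast? = some Step.east := by
  induction cs generalizing x with
  | nil =>
    have := hN x (by simp)
    simp [buildSteps, List.getLast?_replicate]
    omega
  | cons c cs ih =>
    have := ih c fun d hd => hN d (List.mem_cons_of_mem _ hd)
    rw [buildSteps, List.getLast?_append, List.getLast?_cons, this]
    rfl

theorem buildSteps_columnsFrom (N x : ℕ) (p : List Step) (h : x + p.count Step.east = N) :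
    buildSteps N x (columnsFrom x p) = p := by
  induction p generalizing x with
  | nil =>
    have : N - x = 0 := by simp at h; omega
    simp [columnsFrom, buildSteps, this]
  | cons s p ih =>
    cases s with
    | north =>
      rw [columnsFrom, buildSteps, ih x (by simpa using h)]
      simp
    | east =>
      have hc : (Step.east :: p).count Step.east = p.count Step.east + 1 := by simp
      have ih := ih (x + 1) (by omega)
      rw [columnsFrom]
      conv_rhs => rw [← ih]
      cases hcs : columnsFrom (x + 1) p with
      | nil =>
        have : N - x = N - (x + 1) + 1 := by omega
        rw [buildSteps, buildSteps, this, List.replicate_succ]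
      | cons c cs =>
        have hx : x + 1 ≤ c := le_of_mem_columnsFrom (p := p) (by rw [hcs]; simp)
        have : c - x = c - (x + 1) + 1 := by omega
        rw [buildSteps, buildSteps, this, List.replicate_succ, List.cons_append]

/-- Every vertical step starts at a point of the path. -/
theorem exists_take_columnsFrom (x : ℕ) (p : List Step) (i : ℕ)
    (hi : i < (columnsFrom x p).length) : ∃ k ≤ p.length, (p.take k).count Step.north = i ∧
      x + (p.take k).count Step.east = (columnsFrom x p)[i] := by
  induction p generalizing x i with
  | nil => simp [columnsFrom] at hi
  | cons s p ih =>
    cases s with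
    | north =>
      cases i with
      | zero => exact ⟨0, by simp, by simp, by simp [columnsFrom]⟩
      | succ i =>
        obtain ⟨k, hk, h1, h2⟩ := ih x i (by simpa [columnsFrom] using hi)
        exact ⟨k + 1, by simpa using hk, by simp [h1], by simp [columnsFrom, h2]⟩
    | east =>
      obtain ⟨k, hk, h1, h2⟩ := ih (x + 1) i hi
      refine ⟨k + 1, by simpa using hk, by simp [h1], ?_⟩
      change x + _ = (columnsFrom (x + 1) p)[i]
      rw [← h2, List.take_succ_cons, List.count_cons_self]
      ring

/-- No point of the path lies to the right of the next vertical step. -/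
theorem le_getElem_columnsFrom (x : ℕ) (p : List Step) (k : ℕ)
    (hi : (p.take k).count Step.north < (columnsFrom x p).length) :
    x + (p.take k).count Step.east ≤ (columnsFrom x p)[(p.take k).count Step.north] := by
  induction p generalizing x k with
  | nil => simp [columnsFrom] at hi
  | cons s p ih =>
    cases k with
    | zero =>
      simp only [List.take_zero, List.count_nil, add_zero]
      exact le_of_mem_columnsFrom (List.getElem_mem _)
    | succ k =>
      cases s with
      | north =>
        have hi' : (p.take k).count Step.north < (columnsFrom x p).length := by
          simpa [columnsFrom] using hi
        have := ih x k hi'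
        simpa [columnsFrom] using this
      | east =>
        have hi' : (p.take k).count Step.north < (columnsFrom (x + 1) p).length := by
          simpa [columnsFrom] using hi
        have := ih (x + 1) k hi'
        simp only [List.take_succ_cons, List.count_cons_self, columnsFrom]
        simp only [ne_eq, reduceCtorEq, not_false_eq_true, List.count_cons_of_ne]
        omega

namespace SquarePath

variable {N : ℕ}

theorem length_columns (π : SquarePath N) : (columnsFrom 0 π.steps).length = N := by
  rw [length_columnsFrom, π.count_north]

theorem pos (π : SquarePath N) : 0 < N := by
  rw [← π.count_east]
  exact List.count_pos_iff.2 (List.mem_of_getLast? π.ends_east)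

theorem col_lt (π : SquarePath N) (i : Fin N) : π.col i < N := by
  have := lt_of_mem_columnsFrom (x := 0) (c := π.col i) π.ends_east (List.getElem_mem _)
  rwa [π.count_east, zero_add] at this

theorem col_mono (π : SquarePath N) : Monotone π.col := by
  intro i j hij
  rcases hij.eq_or_lt with rfl | hij
  · rfl
  · exact List.pairwise_iff_getElem.1 (pairwise_columnsFrom 0 π.steps) i j
      (by rw [π.length_columns]; exact i.2) (by rw [π.length_columns]; exact j.2) hij

theorem ofFn_col (π : SquarePath N) : List.ofFn π.col = columnsFrom 0 π.steps := by
  apply List.ext_getElem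
  · rw [List.length_ofFn, π.length_columns]
  · intro i h1 h2
    rw [List.getElem_ofFn]
    rfl

theorem ext_col {π π' : SquarePath N} (h : ∀ i, π.col i = π'.col i) : π = π' := by
  have h1 : columnsFrom 0 π.steps = columnsFrom 0 π'.steps := by
    rw [← ofFn_col, ← ofFn_col, funext h]
  have h2 : π.steps = π'.steps := by
    rw [← buildSteps_columnsFrom N 0 π.steps (by rw [π.count_east, zero_add]), h1,
      buildSteps_columnsFrom N 0 π'.steps (by rw [π'.count_east, zero_add])]
  cases π
  cases π'
  cases h2
  rfl

theorem exists_col {c : Fin N → ℕ} (hN : 0 < N) (hc : Monotone c) (hlt : ∀ i, c i < N) :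
    ∃ π : SquarePath N, ∀ i, π.col i = c i := by
  have hp : (0 :: List.ofFn c).Pairwise (· ≤ ·) := by
    rw [List.pairwise_cons, List.pairwise_ofFn]
    exact ⟨fun _ _ => Nat.zero_le _, fun i j h => hc h.le⟩
  have hm : ∀ d ∈ 0 :: List.ofFn c, d < N := by
    intro d hd
    rw [List.mem_cons, List.mem_ofFn] at hd
    rcases hd with rfl | ⟨i, rfl⟩
    · exact hN
    · exact hlt i
  have hcol := columnsFrom_buildSteps N 0 _ hp
  refine ⟨⟨buildSteps N 0 (List.ofFn c), ?_, ?_, getLast?_buildSteps N 0 _ hm⟩, fun i => ?_⟩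
  · rw [← length_columnsFrom _ 0, hcol, List.length_ofFn]
  · rw [count_east_buildSteps N 0 _ hp fun d hd => (hm d hd).le, Nat.sub_zero]
  · simp only [col, hcol, List.getElem_ofFn]

theorem head?_eq_north_iff (π : SquarePath N) (i : Fin N) (hi : (i : ℕ) = 0) :
    π.steps.head? = some Step.north ↔ π.areaWord i = 0 := by
  have hcol : π.areaWord i = 0 ↔ π.col i = 0 := by
    rw [areaWord, hi]; omega
  rw [hcol]
  obtain ⟨i, hiN⟩ := i
  simp only at hi
  subst hi
  obtain ⟨p, h1, h2, h3⟩ := π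
  simp only [col]
  cases p with
  | nil => simp at h3
  | cons s p =>
    cases s with
    | north => simp [columnsFrom]
    | east =>
      simp only [List.head?_cons, Option.some.injEq, reduceCtorEq, false_iff, columnsFrom]
      have hlen : 0 < (columnsFrom 1 p).length := by
        have := length_columnsFrom (Step.east :: p) 0
        rw [h1, columnsFrom, zero_add] at this
        omega
      have := le_of_mem_columnsFrom (x := 1) (p := p) (List.getElem_mem hlen)
      simp only [zero_add]
      omega

theorem base_le_areaWord (π : SquarePath N) (i : Fin N) : π.base ≤ π.areaWord i := by
  obtain ⟨k, hk, h1, h2⟩ := exists_take_columnsFrom 0 π.steps i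
    (by rw [π.length_columns]; exact i.2)
  have h : π.areaWord i = π.height k := by
    rw [areaWord, height, h1, col, ← h2, zero_add]
  rw [h]
  exact Finset.inf'_le _ (Finset.mem_range.2 (by omega))

/-- The base diagonal is reached at the start of a vertical step: the part of the path before the next
vertical step only descends to lower diagonals, and after the last vertical step the path descends to
the main diagonal, which is not below the first vertical step. -/
theorem exists_areaWord_eq_base (π : SquarePath N) : ∃ i, π.areaWord i = π.base := by
  obtain ⟨k, -, hk⟩ := Finset.exists_mem_eq_inf' (s := Finset.range (π.steps.length + 1))
    Finset.nonempty_range_add_one π.height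
  suffices ∃ i, π.areaWord i ≤ π.height k by
    obtain ⟨i, hi⟩ := this
    exact ⟨i, le_antisymm (hi.trans_eq hk.symm) (π.base_le_areaWord i)⟩
  by_cases h : (π.steps.take k).count Step.north < N
  · have := le_getElem_columnsFrom 0 π.steps k (by rw [π.length_columns]; exact h)
    refine ⟨⟨_, h⟩, ?_⟩
    simp only [areaWord, height, col]
    omega
  · refine ⟨⟨0, π.pos⟩, ?_⟩
    have h1 := (List.take_sublist k π.steps).count_le Step.east
    rw [π.count_east] at h1
    simp only [areaWord, height]
    omega

end SquarePath

/-! ### Labelled square paths as words -/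

theorem pairCount_ofFn {α : Type*} (I : α → α → Bool) {N : ℕ} (f : Fin N → α) :
    pairCount I (List.ofFn f) =
      (Finset.univ.filter fun e : Fin N × Fin N => e.1 < e.2 ∧ I (f e.1) (f e.2) = true).card := by
  rw [Finset.card_filter, Fintype.sum_prod_type]
  induction N with
  | zero => simp [pairCount]
  | succ N ih =>
    have h : (List.ofFn fun i : Fin N => f i.succ).countP (I (f 0)) =
        ∑ i : Fin N, if I (f 0) (f i.succ) = true then 1 else 0 := by
      have h' : (List.ofFn fun i : Fin N => f i.succ).countP (I (f 0)) =
          Multiset.countP (fun x => I (f 0) x = true) (List.ofFn fun i : Fin N => f i.succ) := by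
        rw [Multiset.coe_countP]
        simp
      rw [← Finset.card_filter, h', ← Fin.univ_val_map, Multiset.countP_map]
      rfl
    rw [List.ofFn_succ, pairCount, ih, h, Fin.sum_univ_succ]
    congr 1
    · rw [Fin.sum_univ_succ]
      simp
    · apply Finset.sum_congr rfl
      intro i _
      rw [Fin.sum_univ_succ]
      simp

theorem inv_eq_true_iff (x y : ℕ × ℕ) :
    inv x y = true ↔ (x.1 = y.1 ∧ x.2 < y.2) ∨ (x.1 = y.1 + 1 ∧ y.2 < x.2) := decide_eq_true_iff

theorem isWord_ofFn_iff {s N : ℕ} (hN : 0 < N) (f : Fin N → ℕ × ℕ) :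
    IsWord s (List.ofFn f) ↔
      (∀ (i : ℕ) (hi : i + 1 < N), Follows (f ⟨i, by omega⟩) (f ⟨i + 1, hi⟩)) ∧
      ((f ⟨0, hN⟩).1 < s ∨ ((f ⟨0, hN⟩).1 = s ∧ (f ⟨0, hN⟩).2 ≠ 0)) ∧
      s ≤ (f ⟨N - 1, by omega⟩).1 := by
  obtain ⟨N, rfl⟩ : ∃ k, N = k + 1 := ⟨N - 1, by omega⟩
  have h1 : (List.ofFn f).head? = some (f ⟨0, hN⟩) := by
    rw [List.ofFn_succ]; rfl
  have h2 : (List.ofFn f).getLast? = some (f ⟨N + 1 - 1, by omega⟩) := by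
    rw [List.ofFn_succ', List.concat_eq_append, List.getLast?_concat]; rfl
  rw [isWord_iff, h1, h2, List.isChain_ofFn]
  simp

namespace LSQ

variable {m n : ℕ}

theorem size_pos (P : LSQ m n) : 0 < m + n := P.path.pos

/-- The level of the `i`-th vertical step above the base diagonal. -/
def level (P : LSQ m n) (i : Fin (m + n)) : ℕ := (P.path.areaWord i - P.path.base).toNat

theorem level_eq (P : LSQ m n) (i : Fin (m + n)) :
    (P.level i : ℤ) = P.path.areaWord i - P.path.base :=
  Int.toNat_of_nonneg (by have := P.path.base_le_areaWord i; omega)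

/-- The shift as a natural number. -/
def shiftNat (P : LSQ m n) : ℕ := P.shift.toNat

theorem shiftNat_eq (P : LSQ m n) : (P.shiftNat : ℤ) = -P.path.base := by
  have h := P.path.base_le_areaWord ⟨0, P.size_pos⟩
  rw [SquarePath.areaWord] at h
  simp only [Nat.cast_zero] at h
  rw [shiftNat, shift, SquarePath.shift, Int.toNat_of_nonneg]
  omega

theorem areaWord_eq (P : LSQ m n) (i : Fin (m + n)) :
    P.path.areaWord i = (P.level i : ℤ) - P.shiftNat := by
  rw [level_eq, shiftNat_eq]; ring

theorem col_eq (P : LSQ m n) (i : Fin (m + n)) :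
    (P.path.col i : ℤ) = i + P.shiftNat - P.level i := by
  have := P.areaWord_eq i
  rw [SquarePath.areaWord] at this
  omega

/-- The letter of a vertical step: its level and its label. -/
def letter (P : LSQ m n) (i : Fin (m + n)) : ℕ × ℕ := (P.level i, P.label i)

/-- The letters of the vertical steps from bottom to top. -/
def toWord (P : LSQ m n) : List (ℕ × ℕ) := List.ofFn P.letter

/-- The multiset of the letters of a labelled path. -/
def letters (P : LSQ m n) : Multiset (ℕ × ℕ) := Finset.univ.val.map P.letter

theorem coe_toWord (P : LSQ m n) : (P.toWord : Multiset (ℕ × ℕ)) = P.letters :=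
  (Fin.univ_val_map _).symm

theorem mem_letters {P : LSQ m n} {x : ℕ × ℕ} : x ∈ P.letters ↔ ∃ i, P.letter i = x := by
  simp [letters]

theorem isWord_toWord (P : LSQ m n) : IsWord P.shiftNat P.toWord := by
  rw [toWord, isWord_ofFn_iff P.size_pos]
  refine ⟨fun i hi => ?_, ?_, ?_⟩
  · have h1 := P.col_eq ⟨i, by omega⟩
    have h2 := P.col_eq ⟨i + 1, hi⟩
    have h3 := P.path.col_mono (show (⟨i, by omega⟩ : Fin (m + n)) ≤ ⟨i + 1, hi⟩ by
      rw [Fin.mk_le_mk]; omega)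
    have h4 := P.column_strict ⟨i, by omega⟩ ⟨i + 1, hi⟩ (by rw [Fin.mk_lt_mk]; omega)
    simp only [Follows, letter] at *
    push_cast at h1 h2
    by_cases h : P.path.col ⟨i, by omega⟩ = P.path.col ⟨i + 1, hi⟩
    · exact Or.inr ⟨by omega, h4 h⟩
    · left; omega
  · have h1 := P.col_eq ⟨0, P.size_pos⟩
    have h2 := P.path.head?_eq_north_iff ⟨0, P.size_pos⟩ rfl
    have h3 := P.areaWord_eq ⟨0, P.size_pos⟩
    simp only [letter] at *
    push_cast at h1
    by_cases h : P.level ⟨0, P.size_pos⟩ = P.shiftNat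
    · exact Or.inr ⟨h, P.first_nonzero (h2.2 (by omega)) _ rfl⟩
    · left; omega
  · have h1 := P.col_eq ⟨m + n - 1, by have := P.size_pos; omega⟩
    have h2 := P.path.col_lt ⟨m + n - 1, by have := P.size_pos; omega⟩
    have := P.size_pos
    simp only [letter] at *
    omega

theorem ext_toWord {P P' : LSQ m n} (hs : P.shiftNat = P'.shiftNat) (h : P.toWord = P'.toWord) :
    P = P' := by
  have h1 : P.letter = P'.letter := List.ofFn_injective h
  have h2 : P.path = P'.path := by
    apply SquarePath.ext_col
    intro i
    have e1 := P.col_eq i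
    have e2 := P'.col_eq i
    have e3 : P.level i = P'.level i := congrArg Prod.fst (congrFun h1 i)
    omega
  have h3 : P.label = P'.label := funext fun i => congrArg Prod.snd (congrFun h1 i)
  cases P
  cases P'
  cases h2
  cases h3
  rfl

theorem card_filter_letter (P : LSQ m n) (p : ℕ × ℕ → Prop) [DecidablePred p] :
    (Finset.univ.filter fun i => p (P.letter i)).card = P.letters.countP p := by
  rw [letters, Multiset.countP_map]
  rfl

theorem countP_label_zero (P : LSQ m n) : P.letters.countP (fun x => x.2 = 0) = m := by
  rw [← card_filter_letter]
  exact P.card_zero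

theorem exists_base_letter (P : LSQ m n) : ∃ v, v ≠ 0 ∧ (0, v) ∈ P.letters := by
  obtain ⟨i, h1, h2⟩ := P.base_nonzero
  refine ⟨P.label i, h2, mem_letters.2 ⟨i, ?_⟩⟩
  rw [letter, level, h1, sub_self]
  rfl

theorem mem_Pref_iff (P : LSQ m n) :
    P ∈ Pref m n ↔ {c : ℕ | c ≠ 0 ∧ ∃ d, (d, c) ∈ P.letters} = Set.Icc 1 n := by
  have : {c : ℕ | c ≠ 0 ∧ ∃ i, P.label i = c} = {c : ℕ | c ≠ 0 ∧ ∃ d, (d, c) ∈ P.letters} := by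
    ext c
    simp only [Set.mem_ofPred_eq, mem_letters, letter, Prod.mk.injEq]
    constructor
    · rintro ⟨h, i, hi⟩; exact ⟨h, _, i, rfl, hi⟩
    · rintro ⟨h, _, i, _, hi⟩; exact ⟨h, i, hi⟩
  rw [← this]
  rfl

theorem area_eq (P : LSQ m n) : P.area = ((P.letters.map Prod.fst).sum : ℕ) := by
  have : ∀ i, P.path.areaWord i + P.path.shift = ((P.level i : ℕ) : ℤ) := by
    intro i
    rw [level_eq, SquarePath.shift]; ring
  rw [area, SquarePath.area, letters, Multiset.map_map]
  simp only [this]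
  rw [← Nat.cast_sum]
  rfl

theorem dinv_eq (P : LSQ m n) : P.dinv = pairCount inv P.toWord +
    P.letters.countP (fun x => x.1 < P.shiftNat ∧ x.2 ≠ 0) := by
  classical
  rw [dinv, toWord, pairCount_ofFn, ← card_filter_letter]
  congr 2
  · ext e
    rw [Finset.mem_filter, Finset.mem_filter]
    simp only [Finset.mem_univ, true_and, IsInversion, inv_eq_true_iff, letter, areaWord_eq]
    omega
  · ext i
    rw [Finset.mem_filter, Finset.mem_filter]
    simp only [Finset.mem_univ, true_and, letter, areaWord_eq]
    omega

/-- Every word with the letters of a labelled path comes from a labelled path. -/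
theorem exists_toWord_eq (P₀ : LSQ m n) {s : ℕ} {l : List (ℕ × ℕ)} (hl : IsWord s l)
    (hC : (l : Multiset (ℕ × ℕ)) = P₀.letters) : ∃ P : LSQ m n, P.shiftNat = s ∧ P.toWord = l := by
  have hN := P₀.size_pos
  have hlen : l.length = m + n := by
    rw [← Multiset.coe_card, hC, letters]
    simp
  obtain ⟨f, rfl⟩ : ∃ f : Fin (m + n) → ℕ × ℕ, l = List.ofFn f :=
    ⟨fun i => l[i], by
      apply List.ext_getElem
      · simp [hlen]
      · simp⟩
  rw [isWord_ofFn_iff hN] at hl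
  obtain ⟨hch, hhd, hlast⟩ := hl
  have hrise : ∀ (k i : ℕ) (h : i + k < m + n),
      (f ⟨i + k, h⟩).1 ≤ (f ⟨i, by omega⟩).1 + k := by
    intro k
    induction k with
    | zero => intro i h; exact le_rfl
    | succ k ih =>
      intro i h
      have h1 := ih i (by omega)
      have h2 := hch (i + k) h
      simp only [Follows] at h2
      simp only [← add_assoc]
      omega
  have hle : ∀ i : Fin (m + n), (f i).1 ≤ i + s := by
    rintro ⟨i, hi⟩
    have := hrise i 0 (by omega)
    simp only [zero_add] at this
    simp only
    omega
  have hmono : Monotone fun i : Fin (m + n) => (i : ℕ) + s - (f i).1 := by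
    rintro ⟨i, hi⟩ ⟨j, hj⟩ hij
    rw [Fin.mk_le_mk] at hij
    obtain ⟨k, rfl⟩ := Nat.exists_eq_add_of_le hij
    have h1 := hrise k i hj
    have h2 := hle ⟨i, hi⟩
    simp only at h2 ⊢
    omega
  obtain ⟨π, hπ⟩ := SquarePath.exists_col hN hmono (by
    intro i
    have h1 : (i : ℕ) + s - (f i).1 ≤ m + n - 1 + s - (f ⟨m + n - 1, by omega⟩).1 :=
      hmono (a := i) (b := ⟨m + n - 1, by omega⟩) (by rw [Fin.le_def]; simp only; omega)
    omega)
  have harea : ∀ i, π.areaWord i = ((f i).1 : ℤ) - s := by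
    intro i
    have := hle i
    rw [SquarePath.areaWord, hπ i]
    omega
  have hmem : ∀ x, x ∈ P₀.letters ↔ ∃ i, f i = x := by
    intro x
    rw [← hC, Multiset.mem_coe, List.mem_ofFn]
  have hbase : π.base = -(s : ℤ) := by
    apply le_antisymm
    · obtain ⟨v, -, hv⟩ := P₀.exists_base_letter
      obtain ⟨i, hi⟩ := (hmem _).1 hv
      have := π.base_le_areaWord i
      rw [harea, hi] at this
      simpa using this
    · obtain ⟨i, hi⟩ := π.exists_areaWord_eq_base
      rw [← hi, harea]
      omega
  have hcol : ∀ (k i : ℕ) (h : i + 1 + k < m + n), π.col ⟨i, by omega⟩ = π.col ⟨i + 1 + k, h⟩ →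
      (f ⟨i, by omega⟩).2 < (f ⟨i + 1 + k, h⟩).2 := by
    have step : ∀ (i : ℕ) (h : i + 1 < m + n), π.col ⟨i, by omega⟩ = π.col ⟨i + 1, h⟩ →
        (f ⟨i, by omega⟩).2 < (f ⟨i + 1, h⟩).2 := by
      intro i h heq
      have h1 := hle ⟨i, by omega⟩
      have h2 := hle ⟨i + 1, h⟩
      have h3 := hch i h
      rw [hπ, hπ] at heq
      simp only [Follows] at h1 h2 h3 heq
      omega
    intro k
    induction k with
    | zero => intro i h; exact step i h
    | succ k ih =>
      intro i h heq
      have h1 : π.col ⟨i, by omega⟩ ≤ π.col ⟨i + 1 + k, by omega⟩ :=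
        π.col_mono (by rw [Fin.mk_le_mk]; omega)
      have h2 : π.col ⟨i + 1 + k, by omega⟩ ≤ π.col ⟨i + 1 + (k + 1), h⟩ :=
        π.col_mono (by rw [Fin.mk_le_mk]; omega)
      have h3 := ih i (by omega) (by omega)
      have h4 := step (i + 1 + k) (by omega) (by
        have : i + 1 + k + 1 = i + 1 + (k + 1) := by ring
        simp only [this]
        omega)
      exact h3.trans h4
  let P : LSQ m n :=
    { path := π
      label := fun i => (f i).2
      column_strict := by
        rintro ⟨i, hi⟩ ⟨j, hj⟩ hij heq
        rw [Fin.mk_lt_mk] at hij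
        obtain ⟨k, rfl⟩ := Nat.exists_eq_add_of_lt hij
        have e : i + k + 1 = i + 1 + k := by ring
        simp only [e] at heq ⊢
        exact hcol k i (by omega) heq
      base_nonzero := by
        obtain ⟨v, hv0, hv⟩ := P₀.exists_base_letter
        obtain ⟨i, hi⟩ := (hmem _).1 hv
        refine ⟨i, ?_, ?_⟩
        · rw [harea, hi, hbase]; simp
        · rw [hi]; exact hv0
      first_nonzero := by
        rintro h ⟨i, hi⟩ hi0
        rw [π.head?_eq_north_iff ⟨i, hi⟩ hi0, harea] at h
        simp only at hi0
        subst hi0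
        omega
      card_zero := by
        refine Eq.trans ?_ P₀.countP_label_zero
        rw [← hC, ← Fin.univ_val_map, Multiset.countP_map]
        rfl }
  have hs : P.shiftNat = s := by
    have h1 := P.shiftNat_eq
    have h2 : P.path.base = -(s : ℤ) := hbase
    omega
  refine ⟨P, hs, ?_⟩
  rw [toWord]
  congr 1
  funext i
  have h1 := P.areaWord_eq i
  have h2 : P.path.areaWord i = ((f i).1 : ℤ) - s := harea i
  have h3 : P.level i = (f i).1 := by omega
  rw [letter, h3]

theorem mem_Pref_of_letters {P P₀ : LSQ m n} (h : P.letters = P₀.letters) (h₀ : P₀ ∈ Pref m n) :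
    P ∈ Pref m n := by
  rw [mem_Pref_iff, h, ← mem_Pref_iff]
  exact h₀

end LSQ

/-! ### The diagonal word determines the letters -/

/-- The labels on level `d` in increasing order. -/
def levelLabels (C : Multiset (ℕ × ℕ)) (d : ℕ) : List ℕ :=
  ((C.filter fun x => x.1 = d).map Prod.snd).sort

/-- The number of levels, if none is missing. -/
def numLevels (C : Multiset (ℕ × ℕ)) : ℕ := C.toFinset.sup fun x => x.1 + 1

theorem mem_levelLabels {C : Multiset (ℕ × ℕ)} {d v : ℕ} : v ∈ levelLabels C d ↔ (d, v) ∈ C := by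
  simp only [levelLabels, Multiset.mem_sort, Multiset.mem_map, Multiset.mem_filter, Prod.exists]
  constructor
  · rintro ⟨a, b, ⟨h, rfl⟩, rfl⟩; exact h
  · intro h; exact ⟨d, v, ⟨h, rfl⟩, rfl⟩

theorem pairwise_levelLabels (C : Multiset (ℕ × ℕ)) (d : ℕ) :
    (levelLabels C d).Pairwise (· ≤ ·) := Multiset.pairwise_sort _ _

theorem levelLetters_levelLabels (C : Multiset (ℕ × ℕ)) (d : ℕ) :
    levelLetters d (levelLabels C d) = C.filter fun x => x.1 = d := by
  rw [levelLetters, ← Multiset.map_coe, levelLabels, Multiset.sort_eq, Multiset.map_map]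
  conv_rhs => rw [← Multiset.map_id (C.filter fun x => x.1 = d)]
  apply Multiset.map_congr rfl
  rintro ⟨a, b⟩ hx
  simp [← (Multiset.mem_filter.1 hx).2]

theorem lt_numLevels_iff {C : Multiset (ℕ × ℕ)} {d : ℕ} :
    d < numLevels C ↔ ∃ x ∈ C, d ≤ x.1 := by
  rw [numLevels, Finset.lt_sup_iff]
  simp

theorem content_levelLabels (C : Multiset (ℕ × ℕ)) :
    content (levelLabels C) 0 (numLevels C) = C := by
  rw [content]
  simp only [levelLetters_levelLabels]
  ext x
  rw [Multiset.count_sum']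
  simp only [Multiset.count_filter]
  rw [Finset.sum_ite_eq]
  by_cases hx : x ∈ C
  · rw [if_pos]
    rw [Finset.mem_Ico, lt_numLevels_iff]
    exact ⟨Nat.zero_le _, x, hx, le_rfl⟩
  · rw [Multiset.count_eq_zero_of_notMem hx, ite_self]

/-- The labels level by level from the highest level to the lowest one. -/
def labelRuns (C : Multiset (ℕ × ℕ)) : List (List ℕ) :=
  (List.range (numLevels C)).reverse.map (levelLabels C)

theorem eq_of_labelRuns_eq {C C' : Multiset (ℕ × ℕ)} (h : labelRuns C = labelRuns C') : C = C' := by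
  have h1 : numLevels C = numLevels C' := by simpa [labelRuns] using congrArg List.length h
  rw [← content_levelLabels C, ← content_levelLabels C', content, content, ← h1]
  apply Finset.sum_congr rfl
  intro d hd
  rw [labelRuns, labelRuns, ← h1, List.map_inj_left] at h
  rw [h d (by simpa using hd)]

namespace LSQ

variable {m n : ℕ}

theorem sort_labelsOn (P : LSQ m n) (d : ℤ) (k : ℕ) (hk : d = P.path.base + k) :
    (P.labelsOn d).mergeSort (fun a b => decide (a ≤ b)) = levelLabels P.letters k := by
  have h : ((P.labelsOn d : List ℕ) : Multiset ℕ) =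
      (P.letters.filter fun x => x.1 = k).map Prod.snd := by
    rw [labelsOn, letters, Multiset.filter_map, Multiset.map_map, ← Multiset.map_coe,
      ← Multiset.filter_coe]
    have e : (Multiset.filter (fun i => P.path.areaWord i = d) (List.finRange (m + n))) =
        Multiset.filter ((fun x => x.1 = k) ∘ P.letter) Finset.univ.val := by
      apply Multiset.filter_congr
      intro i _
      have := P.level_eq i
      simp only [Function.comp, letter]
      omega
    rw [e]
    rfl
  rw [levelLabels, ← h, Multiset.coe_sort]

theorem labelsOn_eq_nil (P : LSQ m n) (d : ℤ) (h : ∀ k : ℕ, k < numLevels P.letters →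
    d ≠ P.path.base + k) : P.labelsOn d = [] := by
  rw [labelsOn, List.map_eq_nil_iff, List.filter_eq_nil_iff]
  intro i _ hi
  rw [decide_eq_true_eq] at hi
  apply h (P.level i)
  · rw [lt_numLevels_iff]
    exact ⟨P.letter i, mem_letters.2 ⟨i, rfl⟩, le_rfl⟩
  · rw [level_eq, ← hi]; ring

theorem diagWord_eq (P : LSQ m n) : P.diagWord = (labelRuns P.letters).flatten := by
  -- the levels outside the range of the path contribute nothing
  obtain ⟨i, hi⟩ := P.path.exists_areaWord_eq_base
  have hb : -((m + n : ℕ) : ℤ) ≤ P.path.base := by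
    have := P.path.col_lt i
    rw [← hi, SquarePath.areaWord]; omega
  obtain ⟨a, ha⟩ : ∃ a : ℕ, P.path.base = (a : ℤ) - ((m + n : ℕ) : ℤ) :=
    ⟨(P.path.base + ((m + n : ℕ) : ℤ)).toNat, by rw [Int.toNat_of_nonneg] <;> omega⟩
  obtain ⟨r, hr⟩ : ∃ r, 2 * (m + n) = a + (numLevels P.letters + r) := by
    suffices a + numLevels P.letters ≤ 2 * (m + n) from
      ⟨2 * (m + n) - (a + numLevels P.letters), by omega⟩
    have h0 := P.shiftNat_eq
    by_contra hcon
    obtain ⟨x, hx, h2⟩ := (lt_numLevels_iff (C := P.letters)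
      (d := 2 * (m + n) - a)).1 (by omega)
    obtain ⟨j, rfl⟩ := mem_letters.1 hx
    have h3 := P.level_eq j
    rw [SquarePath.areaWord] at h3
    simp only [letter] at h2
    have := j.2
    omega
  have hlev : levels m n = ((List.range' 0 a).map fun k : ℕ => (k : ℤ) - ((m + n : ℕ) : ℤ)) ++
      (((List.range (numLevels P.letters)).map fun k : ℕ => P.path.base + (k : ℤ)) ++
      (List.range' (a + numLevels P.letters) r).map fun k : ℕ => (k : ℤ) - ((m + n : ℕ) : ℤ)) := by
    have h1 : ((List.range (numLevels P.letters)).map fun k : ℕ => P.path.base + (k : ℤ)) =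
        (List.range' a (numLevels P.letters)).map fun k : ℕ => (k : ℤ) - ((m + n : ℕ) : ℤ) := by
      rw [List.range'_eq_map_range, List.map_map]
      apply List.map_congr_left
      intro k _
      simp only [Function.comp, ha]
      push_cast
      ring
    rw [h1, ← List.map_append, ← List.map_append, List.range'_append_1]
    have h2 := List.range'_append_1 (s := 0) (m := a) (n := numLevels P.letters + r)
    rw [zero_add] at h2
    rw [h2, levels, List.range_eq_range', hr]
  have hnil : ∀ (l : List ℕ), (∀ j ∈ l, j < a ∨ a + numLevels P.letters ≤ j) →
      (l.map fun k : ℕ => (k : ℤ) - ((m + n : ℕ) : ℤ)).reverse.flatMap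
        (fun d => (P.labelsOn d).mergeSort (fun a b => decide (a ≤ b))) = [] := by
    intro l hl
    rw [List.flatMap_eq_nil_iff]
    intro d hd
    rw [List.mem_reverse, List.mem_map] at hd
    obtain ⟨j, hj, rfl⟩ := hd
    rw [P.labelsOn_eq_nil, List.mergeSort_nil]
    intro k hk
    have := hl j hj
    omega
  rw [diagWord, hlev, List.reverse_append, List.reverse_append, List.flatMap_append,
    List.flatMap_append, hnil, hnil, List.nil_append, List.append_nil, ← List.map_reverse,
    List.flatMap_map, labelRuns, List.flatMap_def]
  · congr 1
    apply List.map_congr_left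
    intro k _
    exact P.sort_labelsOn _ k rfl
  · intro j hj
    rw [List.mem_range'_1] at hj
    omega
  · intro j hj
    rw [List.mem_range'_1] at hj
    omega

/-- On each level but the lowest some vertical step is directly above one of the level below, where
the path rises to that level. -/
theorem exists_rise (P : LSQ m n) {d : ℕ} (hd : d + 1 < numLevels P.letters) :
    ∃ v w, (d, v) ∈ P.letters ∧ (d + 1, w) ∈ P.letters ∧ v < w := by
  suffices H : ∀ d i, P.level i = d + 1 →
      ∃ v w, (d, v) ∈ P.letters ∧ (d + 1, w) ∈ P.letters ∧ v < w by
    obtain ⟨x, hx, hdx⟩ := lt_numLevels_iff.1 hd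
    obtain ⟨e, he⟩ := Nat.exists_eq_add_of_le hdx
    have hx' : (d + 1 + e, x.2) ∈ P.letters := by rw [← he]; exact hx
    clear hd hx he hdx
    revert hx'
    generalize x.2 = u
    induction e generalizing u with
    | zero =>
      intro hx'
      obtain ⟨i, hi⟩ := mem_letters.1 hx'
      exact H d i (congrArg Prod.fst hi)
    | succ e ih =>
      intro hx'
      obtain ⟨i, hi⟩ := mem_letters.1 hx'
      obtain ⟨v, w, hv, -, -⟩ := H (d + 1 + e) i (congrArg Prod.fst hi)
      exact ih v hv
  intro d i hi
  have hw := P.isWord_toWord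
  rw [toWord, isWord_ofFn_iff P.size_pos] at hw
  obtain ⟨hch, hhd, hlast⟩ := hw
  -- a step below level `d + 1` and a later step not below it
  obtain ⟨a, b, hab, hb, ha1, hb1⟩ : ∃ (a b : ℕ) (hab : a < b) (hb : b < m + n),
      P.level ⟨a, by omega⟩ < d + 1 ∧ d + 1 ≤ P.level ⟨b, hb⟩ := by
    have hpos := P.size_pos
    simp only [letter] at hhd hlast
    by_cases hs : P.shiftNat < d + 1
    · have h0 : (i : ℕ) ≠ 0 := by
        intro h0
        have : i = ⟨0, hpos⟩ := Fin.ext h0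
        rw [this] at hi
        omega
      exact ⟨0, i, by omega, i.2, by omega, hi.ge⟩
    · obtain ⟨v, -, hv⟩ := P.exists_base_letter
      obtain ⟨j, hj⟩ := mem_letters.1 hv
      have hj0 : P.level j = 0 := congrArg Prod.fst hj
      have h0 : (j : ℕ) ≠ m + n - 1 := by
        intro h0
        have : j = ⟨m + n - 1, by omega⟩ := Fin.ext h0
        rw [this] at hj0
        omega
      exact ⟨j, m + n - 1, by omega, by omega, by rw [Fin.eta, hj0]; omega, by omega⟩
  -- the first crossing of level `d + 1` between them
  have hcross : ∃ (k : ℕ) (hk : k + 1 < m + n), P.level ⟨k, by omega⟩ < d + 1 ∧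
      d + 1 ≤ P.level ⟨k + 1, hk⟩ := by
    by_contra hcon
    push Not at hcon
    have : ∀ (c : ℕ) (hc : a + c < m + n), P.level ⟨a + c, hc⟩ < d + 1 := by
      intro c
      induction c with
      | zero => intro _; exact ha1
      | succ c ih => intro hc; exact hcon (a + c) hc (ih (by omega))
    obtain ⟨c, rfl⟩ := Nat.exists_eq_add_of_lt hab
    have := this (c + 1) hb
    simp only [← add_assoc] at this
    omega
  obtain ⟨k, hk, h1, h2⟩ := hcross
  have h3 := hch k hk
  simp only [Follows, letter] at h3
  refine ⟨P.label ⟨k, by omega⟩, P.label ⟨k + 1, hk⟩, mem_letters.2 ⟨⟨k, by omega⟩, ?_⟩,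
    mem_letters.2 ⟨⟨k + 1, hk⟩, ?_⟩, by omega⟩
  · rw [letter, Prod.mk.injEq]; exact ⟨by omega, rfl⟩
  · rw [letter, Prod.mk.injEq]; exact ⟨by omega, rfl⟩

theorem levelLabels_ne_nil (P : LSQ m n) {d : ℕ} (hd : d < numLevels P.letters) :
    levelLabels P.letters d ≠ [] := by
  suffices ∃ v, (d, v) ∈ P.letters by
    obtain ⟨v, hv⟩ := this
    exact List.ne_nil_of_mem (mem_levelLabels.2 hv)
  cases d with
  | zero =>
    obtain ⟨v, -, hv⟩ := P.exists_base_letter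
    exact ⟨v, hv⟩
  | succ d =>
    obtain ⟨v, w, -, hw, -⟩ := P.exists_rise hd
    exact ⟨w, hw⟩

theorem numLevels_pos (P : LSQ m n) : 0 < numLevels P.letters := by
  obtain ⟨v, -, hv⟩ := P.exists_base_letter
  exact lt_numLevels_iff.2 ⟨_, hv, Nat.zero_le _⟩

/-- The runs of the diagonal word are the sorted levels, since the largest label of a level exceeds
the smallest label of the level below. -/
theorem runs_diagWord (P : LSQ m n) : runs P.diagWord = labelRuns P.letters := by
  rw [runs, diagWord_eq]
  apply List.splitBy_flatten
  · intro h
    rw [labelRuns, List.mem_map] at h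
    obtain ⟨d, hd, h⟩ := h
    exact P.levelLabels_ne_nil (by simpa using hd) h
  · intro l hl
    rw [labelRuns, List.mem_map] at hl
    obtain ⟨d, -, rfl⟩ := hl
    simp only [decide_eq_true_eq]
    exact (pairwise_levelLabels _ d).isChain
  · rw [labelRuns, List.isChain_map, List.isChain_reverse]
    obtain ⟨K, hK⟩ : ∃ K, numLevels P.letters = K + 1 :=
      ⟨numLevels P.letters - 1, by have := P.numLevels_pos; omega⟩
    rw [hK, List.isChain_range_succ]
    intro d hd
    obtain ⟨v, w, hv, hw, hvw⟩ := P.exists_rise (d := d) (by omega)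
    refine ⟨P.levelLabels_ne_nil (by omega), P.levelLabels_ne_nil (by omega), ?_⟩
    rw [decide_eq_false_iff_not, not_le]
    have h1 : (levelLabels P.letters d).head (P.levelLabels_ne_nil (by omega)) ≤ v :=
      (pairwise_levelLabels _ d).rel_head (mem_levelLabels.2 hv)
    have h2 : w ≤ (levelLabels P.letters (d + 1)).getLast (P.levelLabels_ne_nil (by omega)) :=
      (pairwise_levelLabels _ (d + 1)).rel_getLast (mem_levelLabels.2 hw)
    exact h1.trans_lt (hvw.trans_le h2)

theorem diagWord_eq_iff (P P' : LSQ m n) : P.diagWord = P'.diagWord ↔ P.letters = P'.letters := by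
  constructor
  · intro h
    apply eq_of_labelRuns_eq
    rw [← runs_diagWord, ← runs_diagWord, h]
  · intro h
    rw [diagWord_eq, diagWord_eq, h]

theorem lastRunNonzero_diagWord (P : LSQ m n) :
    lastRunNonzero P.diagWord = (levelLabels P.letters 0).countP fun v => v ≠ 0 := by
  obtain ⟨K, hK⟩ : ∃ K, numLevels P.letters = K + 1 :=
    ⟨numLevels P.letters - 1, by have := P.numLevels_pos; omega⟩
  rw [lastRunNonzero, runs_diagWord, labelRuns, hK, List.range_succ_eq_map, List.reverse_cons,
    List.map_append, List.map_singleton, List.getLastD_concat]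

end LSQ

/-! ### Inverse descents of the reading word -/

theorem idxOf_lt_idxOf_iff {R : ℕ → ℕ → Prop} (hR : ∀ x y, R x y → ¬ R y x) {l : List ℕ}
    (hl : l.Pairwise R) {x y : ℕ} (hx : x ∈ l) (hy : y ∈ l) :
    l.idxOf x < l.idxOf y ↔ R x y := by
  have key : ∀ {x y : ℕ}, x ∈ l → y ∈ l → l.idxOf x < l.idxOf y → R x y := by
    intro x y hx hy h
    have := List.pairwise_iff_getElem.1 hl _ _ (List.idxOf_lt_length_iff.2 hx)
      (List.idxOf_lt_length_iff.2 hy) h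
    simpa using this
  refine ⟨key hx hy, fun h => ?_⟩
  rcases lt_trichotomy (l.idxOf x) (l.idxOf y) with h1 | h1 | h1
  · exact h1
  · rw [List.idxOf_inj hx] at h1
    subst h1
    exact absurd h (hR _ _ h)
  · exact absurd h (hR _ _ (key hy hx h1))

theorem mem_ides_iff {u : List ℕ} {i : ℕ} :
    i ∈ ides u ↔ (1 ≤ i ∧ i < u.length) ∧ u.idxOf (i + 1) < u.idxOf i := by
  rw [ides, descents, Finset.mem_filter, Finset.mem_Ico]
  have hlen : (inverseWord u).length = u.length := by simp [inverseWord]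
  rw [hlen]
  apply and_congr_right
  rintro ⟨h1, h2⟩
  have hget : ∀ k, k < u.length → (inverseWord u).getD k 0 = u.idxOf (k + 1) + 1 := by
    intro k hk
    simp [inverseWord, hk]
  rw [hget i h2, hget (i - 1) (by omega), Nat.sub_add_cancel h1]
  omega

namespace LSQ

variable {m n : ℕ}

theorem label_eq_zero_or {P : LSQ m n} (hP : P ∈ Pref m n) (i : Fin (m + n)) :
    P.label i = 0 ∨ ∃ x : Fin n, P.label i = x + 1 := by
  by_cases h : P.label i = 0
  · exact Or.inl h
  · right
    have : P.label i ∈ Set.Icc 1 n := by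
      rw [← hP]; exact ⟨h, i, rfl⟩
    obtain ⟨h1, h2⟩ := this
    exact ⟨⟨P.label i - 1, by omega⟩, by simp only; omega⟩

theorem exists_label_eq {P : LSQ m n} (hP : P ∈ Pref m n) (x : Fin n) :
    ∃ i, P.label i = x + 1 := by
  have : (x + 1 : ℕ) ∈ Set.Icc 1 n := ⟨by omega, by omega⟩
  rw [← hP] at this
  exact this.2

/-- The position of the nonzero label `x + 1`. -/
noncomputable def position {P : LSQ m n} (hP : P ∈ Pref m n) (x : Fin n) : Fin (m + n) :=
  (exists_label_eq hP x).choose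

theorem label_position {P : LSQ m n} (hP : P ∈ Pref m n) (x : Fin n) :
    P.label (position hP x) = x + 1 := (exists_label_eq hP x).choose_spec

/-- There are only `n` places for the `n` nonzero labels, so none of them occurs twice. -/
theorem label_injOn {P : LSQ m n} (hP : P ∈ Pref m n) {i j : Fin (m + n)} (hi : P.label i ≠ 0)
    (h : P.label i = P.label j) : i = j := by
  have hcard : (Finset.univ.filter fun i => ¬ P.label i = 0).card = n := by
    have h1 := Finset.card_filter_add_card_filter_not (s := Finset.univ) (fun i => P.label i = 0)
    rw [P.card_zero, Finset.card_univ, Fintype.card_fin] at h1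
    omega
  have hsurj : Set.SurjOn P.label (Finset.univ.filter fun i => ¬ P.label i = 0)
      (Finset.Icc 1 n : Finset ℕ) := by
    intro c hc
    rw [Finset.coe_Icc] at hc
    have hc' := hc
    rw [← hP] at hc'
    obtain ⟨h0, k, hk⟩ := hc'
    exact ⟨k, by simpa [hk] using h0, hk⟩
  have hinj : Set.InjOn P.label (Finset.univ.filter fun i => ¬ P.label i = 0) :=
    Finset.injOn_of_surjOn_of_card_le _ (by
      intro k hk
      rcases label_eq_zero_or hP k with h0 | ⟨x, hx⟩
      · simp [h0] at hk
      · rw [hx, Finset.coe_Icc]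
        exact ⟨by omega, by omega⟩) hsurj (by simp [hcard])
  exact hinj (by simpa using hi) (by simpa [← h] using hi) h

theorem eq_position {P : LSQ m n} (hP : P ∈ Pref m n) {i : Fin (m + n)} {x : Fin n}
    (h : P.label i = x + 1) : i = position hP x :=
  label_injOn hP (by omega) (by rw [h, label_position])

theorem position_injective {P : LSQ m n} (hP : P ∈ Pref m n) :
    Function.Injective (position hP) := by
  intro x y h
  have h1 := label_position hP x
  rw [h, label_position] at h1
  exact Fin.ext (by omega)

/-- Whether the step labelled `c` comes before the one labelled `c'` in the reading order. -/
def Before (P : LSQ m n) (c c' : ℕ) : Prop :=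
  ∀ i j, P.label i = c → P.label j = c' → P.path.areaWord i < P.path.areaWord j ∨
    (P.path.areaWord i = P.path.areaWord j ∧ i < j)

theorem mem_readingWord {P : LSQ m n} {c : ℕ} :
    c ∈ P.readingWord ↔ c ≠ 0 ∧ ∃ i, P.label i = c := by
  simp only [readingWord, labelsOn, List.mem_flatMap, List.mem_filter, List.mem_map,
    List.mem_finRange, true_and, decide_eq_true_eq]
  constructor
  · rintro ⟨d, -, ⟨i, -, hi⟩, hc⟩
    exact ⟨hc, i, hi⟩
  · rintro ⟨hc, i, hi⟩
    refine ⟨P.path.areaWord i, ?_, ⟨i, rfl, hi⟩, hc⟩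
    have h1 := P.path.col_lt i
    simp only [levels, List.mem_map, List.mem_range]
    refine ⟨(P.path.areaWord i + ((m + n : ℕ) : ℤ)).toNat, ?_, ?_⟩ <;>
    · rw [SquarePath.areaWord]
      omega

theorem pairwise_readingWord {P : LSQ m n} (hP : P ∈ Pref m n) :
    P.readingWord.Pairwise P.Before := by
  rw [readingWord, List.pairwise_flatMap]
  constructor
  · intro d _
    rw [List.pairwise_filter, labelsOn, List.pairwise_map, List.pairwise_filter]
    apply (List.pairwise_lt_finRange _).imp
    intro i j hij hi hj hi0 hj0 i' j' hi' hj'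
    simp only [decide_eq_true_eq] at hi hj hi0 hj0
    rw [← label_injOn hP hi0 hi'.symm, ← label_injOn hP hj0 hj'.symm]
    exact Or.inr ⟨hi.trans hj.symm, hij⟩
  · rw [levels, List.pairwise_map]
    apply List.pairwise_lt_range.imp
    intro a b hab c hc c' hc' i j hi hj
    simp only [labelsOn, List.mem_filter, List.mem_map, List.mem_finRange, true_and,
      decide_eq_true_eq] at hc hc'
    obtain ⟨⟨i', hi', hci⟩, hc0⟩ := hc
    obtain ⟨⟨j', hj', hcj⟩, hc0'⟩ := hc'
    have e1 : i' = i := label_injOn hP (by rwa [hci]) (by rw [hci, hi])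
    have e2 : j' = j := label_injOn hP (by rwa [hcj]) (by rw [hcj, hj])
    subst e1 e2
    left
    omega

theorem before_position_iff {P : LSQ m n} (hP : P ∈ Pref m n) (x y : Fin n) :
    P.Before (x + 1) (y + 1) ↔ P.level (position hP x) < P.level (position hP y) ∨
      (P.level (position hP x) = P.level (position hP y) ∧ position hP x < position hP y) := by
  constructor
  · intro h
    have := h _ _ (label_position hP x) (label_position hP y)
    rw [areaWord_eq, areaWord_eq] at this
    omega
  · intro h i j hi hj
    rw [eq_position hP hi, eq_position hP hj, areaWord_eq, areaWord_eq]
    omega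

theorem length_readingWord {P : LSQ m n} (hP : P ∈ Pref m n) : P.readingWord.length = n := by
  have hnd : P.readingWord.Nodup := by
    rw [List.Nodup, List.pairwise_iff_forall_sublist]
    intro a b hab heq
    have h1 := List.pairwise_iff_forall_sublist.1 (pairwise_readingWord hP) hab
    have hm : a ∈ P.readingWord := hab.subset (by simp)
    rw [mem_readingWord] at hm
    obtain ⟨-, i, hi⟩ := hm
    have := h1 i i hi (hi.trans heq)
    omega
  have : P.readingWord.toFinset = Finset.Icc 1 n := by
    ext c
    rw [List.mem_toFinset, mem_readingWord, Finset.mem_Icc, ← Set.mem_Icc, ← hP]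
    rfl
  rw [← List.toFinset_card_of_nodup hnd, this, Nat.card_Icc, Nat.add_sub_cancel]

/-- The inverse descents are the labels `i` that precede `i + 1` in the reading order. -/
theorem mem_ides {P : LSQ m n} (hP : P ∈ Pref m n) {i : ℕ} :
    i ∈ P.ides ↔ (1 ≤ i ∧ i < n) ∧ P.Before i (i + 1) := by
  rw [ides, mem_ides_iff, List.length_reverse, length_readingWord hP]
  apply and_congr_right
  rintro ⟨h1, h2⟩
  have hasymm : ∀ a b, P.Before b a ∧ a ∈ P.readingWord ∧ b ∈ P.readingWord →
      ¬ (P.Before a b ∧ b ∈ P.readingWord ∧ a ∈ P.readingWord) := by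
    rintro a b ⟨hba, ha, hb⟩ ⟨hab, -, -⟩
    obtain ⟨-, i, hi⟩ := mem_readingWord.1 ha
    obtain ⟨-, j, hj⟩ := mem_readingWord.1 hb
    have e1 := hab i j hi hj
    have e2 := hba j i hj hi
    omega
  have hpw : P.readingWord.reverse.Pairwise
      fun a b => P.Before b a ∧ a ∈ P.readingWord ∧ b ∈ P.readingWord := by
    rw [List.pairwise_reverse]
    exact (pairwise_readingWord hP).imp_of_mem fun ha hb h => ⟨h, hb, ha⟩
  have hmem : ∀ c, 1 ≤ c → c ≤ n → c ∈ P.readingWord := by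
    intro c hc1 hc2
    obtain ⟨i, hi⟩ := exists_label_eq hP ⟨c - 1, by omega⟩
    refine mem_readingWord.2 ⟨by omega, i, ?_⟩
    rw [hi]
    simp only
    omega
  have hm1 := hmem i h1 (by omega)
  have hm2 := hmem (i + 1) (by omega) (by omega)
  rw [idxOf_lt_idxOf_iff hasymm hpw (List.mem_reverse.2 hm2) (List.mem_reverse.2 hm1)]
  exact ⟨fun h => h.1, fun h => ⟨h, hm2, hm1⟩⟩

/-- The level of a nonzero label depends only on the letters. -/
theorem level_position_eq {P P' : LSQ m n} (hP : P ∈ Pref m n) (hP' : P' ∈ Pref m n)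
    (h : P.letters = P'.letters) (x : Fin n) :
    P.level (position hP x) = P'.level (position hP' x) := by
  have hm : P.letter (position hP x) ∈ P'.letters := by
    rw [← h]; exact mem_letters.2 ⟨_, rfl⟩
  obtain ⟨j, hj⟩ := mem_letters.1 hm
  rw [letter, letter, Prod.mk.injEq, label_position] at hj
  rw [← hj.1, eq_position hP' hj.2]

end LSQ

/-! ### Permutations of consecutive labels on one level -/

/-- The index of the block of the label `x + 1`, where a block is a maximal set of consecutive
nonzero labels on one level and `L x` is the level of the label `x + 1`. -/
def blockIndex (L : ℕ → ℕ) (x : ℕ) : ℕ := ((Finset.range x).filter fun j => L j ≠ L (j + 1)).card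

theorem blockIndex_mono (L : ℕ → ℕ) : Monotone (blockIndex L) := fun _ _ h =>
  Finset.card_le_card (Finset.filter_subset_filter _ (Finset.range_mono h))

theorem blockIndex_succ (L : ℕ → ℕ) (x : ℕ) :
    blockIndex L (x + 1) = blockIndex L x + if L x ≠ L (x + 1) then 1 else 0 := by
  rw [blockIndex, Finset.range_add_one, Finset.filter_insert]
  split_ifs with h
  · rw [Finset.card_insert_of_notMem (by simp)]
    rfl
  · rfl

theorem level_eq_of_blockIndex_eq {L : ℕ → ℕ} {x y : ℕ} (h : blockIndex L x = blockIndex L y) :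
    L x = L y := by
  have key : ∀ k x, blockIndex L x = blockIndex L (x + k) → L x = L (x + k) := by
    intro k
    induction k with
    | zero => intro x _; rfl
    | succ k ih =>
      intro x hx
      have h1 := blockIndex_mono L (show x ≤ x + k by omega)
      have h2 := blockIndex_succ L (x + k)
      rw [← add_assoc] at hx ⊢
      split_ifs at h2 with h3
      · omega
      · rw [ih x (by omega)]
        exact not_not.1 h3
  rcases le_total x y with hxy | hxy
  · obtain ⟨k, rfl⟩ := Nat.exists_eq_add_of_le hxy
    exact key k x h
  · obtain ⟨k, rfl⟩ := Nat.exists_eq_add_of_le hxy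
    exact (key k y h.symm).symm

/-- Permutations that preserve the blocks. -/
def PreservesBlocks (L : ℕ → ℕ) {n : ℕ} (g : Equiv.Perm (Fin n)) : Prop :=
  ∀ x, blockIndex L (g x) = blockIndex L x

theorem PreservesBlocks.inv {L : ℕ → ℕ} {n : ℕ} {g : Equiv.Perm (Fin n)}
    (hg : PreservesBlocks L g) : PreservesBlocks L g⁻¹ := by
  intro x
  rw [← hg (g⁻¹ x), Equiv.Perm.inv_def, Equiv.apply_symm_apply]

theorem PreservesBlocks.lt_iff {L : ℕ → ℕ} {n : ℕ} {g : Equiv.Perm (Fin n)}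
    (hg : PreservesBlocks L g) {x y : Fin n} (h : blockIndex L x ≠ blockIndex L y) :
    g x < g y ↔ x < y := by
  have h1 : ∀ {a b : Fin n}, blockIndex L a < blockIndex L b → a < b := fun hab =>
    (blockIndex_mono L).reflect_lt hab
  have hx := hg x
  have hy := hg y
  rcases lt_or_gt_of_ne h with h2 | h2
  · exact ⟨fun _ => h1 h2, fun _ => h1 (by omega)⟩
  · have a1 : y < x := h1 h2
    have a2 : g y < g x := h1 (by omega)
    exact ⟨fun h => absurd h a2.asymm, fun h => absurd h a1.asymm⟩

/-- The action of a permutation on labels; it fixes the label `0`. -/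
def permLabel {n : ℕ} (g : Equiv.Perm (Fin n)) (c : ℕ) : ℕ :=
  if h : c ≠ 0 ∧ c - 1 < n then g ⟨c - 1, h.2⟩ + 1 else c

theorem permLabel_zero {n : ℕ} (g : Equiv.Perm (Fin n)) : permLabel g 0 = 0 := by
  simp [permLabel]

theorem permLabel_succ {n : ℕ} (g : Equiv.Perm (Fin n)) (x : Fin n) :
    permLabel g (x + 1) = g x + 1 := by
  simp [permLabel]

/-- Nonzero labels in one block. -/
def SameBlock (L : ℕ → ℕ) (c c' : ℕ) : Prop :=
  c ≠ 0 ∧ c' ≠ 0 ∧ blockIndex L (c - 1) = blockIndex L (c' - 1)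

namespace LSQ

variable {m n : ℕ}

theorem permLabel_lt_iff {L : ℕ → ℕ} {P : LSQ m n} (hP : P ∈ Pref m n) {g : Equiv.Perm (Fin n)}
    (hg : PreservesBlocks L g) {i j : Fin (m + n)} (h : ¬ SameBlock L (P.label i) (P.label j)) :
    permLabel g (P.label i) < permLabel g (P.label j) ↔ P.label i < P.label j := by
  rcases label_eq_zero_or hP i with hi | ⟨x, hx⟩ <;> rcases label_eq_zero_or hP j with hj | ⟨y, hy⟩
  · rw [hi, hj]; simp
  · rw [hi, hy, permLabel_zero, permLabel_succ]; omega
  · rw [hx, hj, permLabel_zero, permLabel_succ]; omega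
  · rw [hx, hy, permLabel_succ, permLabel_succ]
    have : blockIndex L x ≠ blockIndex L y := fun heq =>
      h ⟨by omega, by omega, by rw [hx, hy]; simpa using heq⟩
    have := hg.lt_iff this
    rw [Fin.lt_def, Fin.lt_def] at this
    omega

theorem sameBlock_permLabel_iff {L : ℕ → ℕ} {P : LSQ m n} (hP : P ∈ Pref m n)
    {g : Equiv.Perm (Fin n)} (hg : PreservesBlocks L g) (i j : Fin (m + n)) :
    SameBlock L (permLabel g (P.label i)) (permLabel g (P.label j)) ↔
      SameBlock L (P.label i) (P.label j) := by
  rcases label_eq_zero_or hP i with hi | ⟨x, hx⟩ <;> rcases label_eq_zero_or hP j with hj | ⟨y, hy⟩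
  · simp [SameBlock, hi, hj, permLabel_zero]
  · simp [SameBlock, hi, permLabel_zero]
  · simp [SameBlock, hj, permLabel_zero]
  · simp [SameBlock, hx, hy, permLabel_succ, hg x, hg y]

theorem not_sameBlock_of_level_ne {L : ℕ → ℕ} {P : LSQ m n} (hP : P ∈ Pref m n)
    (hL : ∀ x, P.level (position hP x) = L x) {i j : Fin (m + n)} (h : P.level i ≠ P.level j) :
    ¬ SameBlock L (P.label i) (P.label j) := by
  rintro ⟨h1, h2, h3⟩
  obtain ⟨x, hx⟩ := (label_eq_zero_or hP i).resolve_left h1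
  obtain ⟨y, hy⟩ := (label_eq_zero_or hP j).resolve_left h2
  rw [hx, hy, Nat.add_sub_cancel, Nat.add_sub_cancel] at h3
  apply h
  rw [eq_position hP hx, eq_position hP hy, hL, hL, level_eq_of_blockIndex_eq h3]

theorem permLabel_column_strict {L : ℕ → ℕ} {P : LSQ m n} (hP : P ∈ Pref m n)
    (hL : ∀ x, P.level (position hP x) = L x) {g : Equiv.Perm (Fin n)} (hg : PreservesBlocks L g)
    (i j : Fin (m + n)) (hij : i < j) (hcol : P.path.col i = P.path.col j) :
    permLabel g (P.label i) < permLabel g (P.label j) := by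
  rw [permLabel_lt_iff hP hg]
  · exact P.column_strict i j hij hcol
  · apply not_sameBlock_of_level_ne hP hL
    have h1 := P.col_eq i
    have h2 := P.col_eq j
    omega

theorem permLabel_eq_zero_iff {P : LSQ m n} (hP : P ∈ Pref m n) (g : Equiv.Perm (Fin n))
    (i : Fin (m + n)) : permLabel g (P.label i) = 0 ↔ P.label i = 0 := by
  rcases label_eq_zero_or hP i with hi | ⟨x, hx⟩
  · simp [hi, permLabel_zero]
  · simp [hx, permLabel_succ]

/-- The labelled path with permuted labels. -/
def relabel {L : ℕ → ℕ} {P : LSQ m n} (hP : P ∈ Pref m n)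
    (hL : ∀ x, P.level (position hP x) = L x) {g : Equiv.Perm (Fin n)}
    (hg : PreservesBlocks L g) : LSQ m n where
  path := P.path
  label := fun i => permLabel g (P.label i)
  column_strict := permLabel_column_strict hP hL hg
  base_nonzero := by
    obtain ⟨i, h1, h2⟩ := P.base_nonzero
    exact ⟨i, h1, by rwa [ne_eq, permLabel_eq_zero_iff hP]⟩
  first_nonzero := by
    intro h i hi
    rw [ne_eq, permLabel_eq_zero_iff hP]
    exact P.first_nonzero h i hi
  card_zero := by
    simp only [permLabel_eq_zero_iff hP]
    exact P.card_zero

section Relabel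

variable {L : ℕ → ℕ} {P : LSQ m n} (hP : P ∈ Pref m n)
  (hL : ∀ x, P.level (position hP x) = L x) {g : Equiv.Perm (Fin n)} (hg : PreservesBlocks L g)

theorem letters_relabel : (relabel hP hL hg).letters = P.letters := by
  have hex : ∀ i, ∃ j, P.letter j = (relabel hP hL hg).letter i := by
    intro i
    rcases label_eq_zero_or hP i with hi | ⟨x, hx⟩
    · refine ⟨i, ?_⟩
      rw [letter, letter, Prod.mk.injEq]
      exact ⟨rfl, by rw [hi]; change 0 = permLabel g (P.label i); rw [hi, permLabel_zero]⟩
    · refine ⟨position hP (g x), ?_⟩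
      rw [letter, letter, Prod.mk.injEq, label_position]
      constructor
      · change P.level _ = P.level i
        rw [eq_position hP hx, hL, hL, level_eq_of_blockIndex_eq (hg x)]
      · change _ = permLabel g (P.label i)
        rw [hx, permLabel_succ]
  -- the zeros stay where they are, the other letters are permuted
  let τ : Fin (m + n) → Fin (m + n) := fun i => if P.label i = 0 then i else (hex i).choose
  have hτ : ∀ i, P.letter (τ i) = (relabel hP hL hg).letter i := by
    intro i
    by_cases hi : P.label i = 0
    · simp only [τ, if_pos hi]
      rw [letter, letter, Prod.mk.injEq]
      exact ⟨rfl, by rw [hi]; change 0 = permLabel g (P.label i); rw [hi, permLabel_zero]⟩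
    · simp only [τ, if_neg hi]
      exact (hex i).choose_spec
  have hlab : ∀ i, P.label (τ i) = permLabel g (P.label i) := fun i => congrArg Prod.snd (hτ i)
  have hinj : Function.Injective τ := by
    intro i j h
    have h1 : permLabel g (P.label i) = permLabel g (P.label j) := by rw [← hlab, ← hlab, h]
    rcases label_eq_zero_or hP i with hi | ⟨x, hx⟩
    · have hj : P.label j = 0 := by
        rw [← permLabel_eq_zero_iff hP g, ← h1, hi, permLabel_zero]
      simpa [τ, hi, hj] using h
    · rcases label_eq_zero_or hP j with hj | ⟨y, hy⟩
      · rw [hx, hj, permLabel_zero, permLabel_succ] at h1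
        omega
      · rw [hx, hy, permLabel_succ, permLabel_succ] at h1
        have hxy : x = y := g.injective (Fin.ext (by omega))
        rw [eq_position hP hx, eq_position hP hy, hxy]
  have hbij : Function.Bijective τ := Finite.injective_iff_bijective.1 hinj
  have : (relabel hP hL hg).letter = P.letter ∘ Equiv.ofBijective τ hbij := by
    funext i
    exact (hτ i).symm
  rw [letters, letters, this, ← Multiset.map_map, Multiset.map_univ_val_equiv]

theorem relabel_mem_Pref : relabel hP hL hg ∈ Pref m n :=
  mem_Pref_of_letters (letters_relabel hP hL hg) hP

theorem position_relabel (x : Fin n) :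
    position (relabel_mem_Pref hP hL hg) (g x) = position hP x := by
  symm
  apply eq_position
  change permLabel g (P.label _) = _
  rw [label_position, permLabel_succ]

theorem level_position_relabel (x : Fin n) :
    (relabel hP hL hg).level (position (relabel_mem_Pref hP hL hg) x) = L x := by
  rw [level_position_eq (relabel_mem_Pref hP hL hg) hP (letters_relabel hP hL hg), hL]

theorem relabel_relabel {g' : Equiv.Perm (Fin n)} (hg' : PreservesBlocks L g')
    (h : ∀ x, g' (g x) = x) :
    relabel (relabel_mem_Pref hP hL hg) (level_position_relabel hP hL hg) hg' = P := by
  have : (fun i => permLabel g' (permLabel g (P.label i))) = P.label := by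
    funext i
    rcases label_eq_zero_or hP i with hi | ⟨x, hx⟩
    · simp [hi, permLabel_zero]
    · simp [hx, permLabel_succ, h]
  cases P
  simp only [relabel]
  congr 1

end Relabel

/-- The order of the positions of the labels within each block, as the permutation that sorts the
labels by block and position. -/
noncomputable def pattern (L : ℕ → ℕ) {P : LSQ m n} (hP : P ∈ Pref m n) : Equiv.Perm (Fin n) :=
  Tuple.sort fun x : Fin n => toLex (blockIndex L x, position hP x)

theorem strictMono_pattern (L : ℕ → ℕ) {P : LSQ m n} (hP : P ∈ Pref m n) :
    StrictMono ((fun x : Fin n => toLex (blockIndex L x, position hP x)) ∘ pattern L hP) := by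
  apply (Tuple.monotone_sort _).strictMono_of_injective
  apply Function.Injective.comp _ (Equiv.injective _)
  intro x y h
  exact position_injective hP (congrArg Prod.snd (toLex.injective h))

theorem preservesBlocks_pattern (L : ℕ → ℕ) {P : LSQ m n} (hP : P ∈ Pref m n) :
    PreservesBlocks L (pattern L hP) := by
  have h1 : Monotone ((fun x : Fin n => blockIndex L x) ∘ pattern L hP) := by
    intro x y hxy
    have := (strictMono_pattern L hP).monotone hxy
    rcases Prod.Lex.le_iff.1 this with h | h
    · exact le_of_lt h
    · exact h.1.le
  have h2 : Monotone ((fun x : Fin n => blockIndex L x) ∘ (1 : Equiv.Perm (Fin n))) := by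
    intro x y hxy
    exact blockIndex_mono L hxy
  exact congrFun (Tuple.unique_monotone h1 h2)

theorem position_lt_iff (L : ℕ → ℕ) {P : LSQ m n} (hP : P ∈ Pref m n) {x y : Fin n}
    (h : blockIndex L x = blockIndex L y) :
    position hP x < position hP y ↔ (pattern L hP)⁻¹ x < (pattern L hP)⁻¹ y := by
  rw [← (strictMono_pattern L hP).lt_iff_lt]
  simp only [Function.comp, Equiv.Perm.inv_def, Equiv.apply_symm_apply]
  rw [Prod.Lex.lt_iff]
  simp [h]

theorem pattern_relabel {L : ℕ → ℕ} {P : LSQ m n} (hP : P ∈ Pref m n)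
    (hL : ∀ x, P.level (position hP x) = L x) {g : Equiv.Perm (Fin n)}
    (hg : PreservesBlocks L g) :
    pattern L (relabel_mem_Pref hP hL hg) = g * pattern L hP := by
  have h1 := (strictMono_pattern L (relabel_mem_Pref hP hL hg)).monotone
  have h2 : Monotone ((fun x : Fin n => toLex (blockIndex L x,
      position (relabel_mem_Pref hP hL hg) x)) ∘ (g * pattern L hP : Equiv.Perm (Fin n))) := by
    have := (strictMono_pattern L hP).monotone
    intro x y hxy
    have h := this hxy
    simp only [Function.comp, Equiv.Perm.mul_apply, position_relabel, hg _] at h ⊢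
    exact h
  have h3 := Tuple.unique_monotone h1 h2
  ext x
  have h4 := congrFun h3 x
  have := position_injective (relabel_mem_Pref hP hL hg) (congrArg Prod.snd (toLex.injective h4))
  rw [this]

open Classical in
/-- The inversions between labels of different blocks, and the bonus. -/
noncomputable def crossDinv (L : ℕ → ℕ) (P : LSQ m n) : ℕ :=
  (Finset.univ.filter fun e : Fin (m + n) × Fin (m + n) => (e.1 < e.2 ∧ P.IsInversion e.1 e.2) ∧
      ¬ SameBlock L (P.label e.1) (P.label e.2)).card +
    (Finset.univ.filter fun i : Fin (m + n) => P.path.areaWord i < 0 ∧ P.label i ≠ 0).card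

/-- The number of the inversions within the blocks. -/
def patternInv (L : ℕ → ℕ) (σ : Equiv.Perm (Fin n)) : ℕ :=
  (Finset.univ.filter fun e : Fin n × Fin n =>
    blockIndex L e.1 = blockIndex L e.2 ∧ e.1 < e.2 ∧ σ⁻¹ e.1 < σ⁻¹ e.2).card

theorem dinv_eq_crossDinv_add {L : ℕ → ℕ} {P : LSQ m n} (hP : P ∈ Pref m n)
    (hL : ∀ x, P.level (position hP x) = L x) :
    P.dinv = P.crossDinv L + patternInv L (pattern L hP) := by
  classical
  have h1 := Finset.card_filter_add_card_filter_not
    (s := Finset.univ.filter fun e : Fin (m + n) × Fin (m + n) =>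
      e.1 < e.2 ∧ P.IsInversion e.1 e.2)
    (fun e => SameBlock L (P.label e.1) (P.label e.2))
  rw [Finset.filter_filter, Finset.filter_filter] at h1
  have h2 : (Finset.univ.filter fun e : Fin (m + n) × Fin (m + n) =>
      (e.1 < e.2 ∧ P.IsInversion e.1 e.2) ∧ SameBlock L (P.label e.1) (P.label e.2)).card =
      patternInv L (pattern L hP) := by
    symm
    apply Finset.card_bij fun (e : Fin n × Fin n) _ => (position hP e.1, position hP e.2)
    · rintro ⟨x, y⟩ h
      rw [Finset.mem_filter] at h ⊢
      obtain ⟨-, h1, h2, h3⟩ := h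
      rw [← position_lt_iff L hP h1] at h3
      refine ⟨Finset.mem_univ _, ⟨h3, Or.inl ⟨?_, ?_⟩⟩, ?_, ?_, ?_⟩
      · simp only at h1
        rw [areaWord_eq, areaWord_eq, hL, hL, level_eq_of_blockIndex_eq h1]
      · rw [label_position, label_position]
        exact Nat.add_lt_add_right h2 1
      · rw [label_position]; omega
      · rw [label_position]; omega
      · rw [label_position, label_position, Nat.add_sub_cancel, Nat.add_sub_cancel]
        exact h1
    · rintro ⟨x, y⟩ _ ⟨x', y'⟩ _ h
      rw [Prod.mk.injEq] at h ⊢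
      exact ⟨position_injective hP h.1, position_injective hP h.2⟩
    · rintro ⟨i, j⟩ h
      rw [Finset.mem_filter] at h
      obtain ⟨-, ⟨h1, h2⟩, h3⟩ := h
      have hlev : P.level i = P.level j := by
        by_contra hne
        exact not_sameBlock_of_level_ne hP hL hne h3
      obtain ⟨hi, hj, hb⟩ := h3
      obtain ⟨x, hx⟩ := (label_eq_zero_or hP i).resolve_left hi
      obtain ⟨y, hy⟩ := (label_eq_zero_or hP j).resolve_left hj
      simp only [IsInversion, areaWord_eq, hx, hy] at h1 h2 hb
      rw [Nat.add_sub_cancel, Nat.add_sub_cancel] at hb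
      have ex := eq_position hP hx
      have ey := eq_position hP hy
      refine ⟨(x, y), ?_, by rw [← ex, ← ey]⟩
      rw [Finset.mem_filter]
      refine ⟨Finset.mem_univ _, hb, ?_, ?_⟩
      · simp only [Fin.lt_def]; omega
      · rw [← position_lt_iff L hP hb, ← ex, ← ey]
        exact h1
  rw [h2] at h1
  rw [dinv, crossDinv]
  rw [← h1]
  ring

theorem crossDinv_relabel {L : ℕ → ℕ} {P : LSQ m n} (hP : P ∈ Pref m n)
    (hL : ∀ x, P.level (position hP x) = L x) {g : Equiv.Perm (Fin n)}
    (hg : PreservesBlocks L g) :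
    (relabel hP hL hg).crossDinv L = P.crossDinv L := by
  classical
  rw [crossDinv, crossDinv]
  congr 2
  · ext ⟨i, j⟩
    rw [Finset.mem_filter, Finset.mem_filter]
    apply and_congr_right
    intro _
    have e1 : (relabel hP hL hg).path = P.path := rfl
    have e2 : ∀ k, (relabel hP hL hg).label k = permLabel g (P.label k) := fun _ => rfl
    simp only [IsInversion, e1, e2, sameBlock_permLabel_iff hP hg]
    apply and_congr_left
    intro hsb
    rw [permLabel_lt_iff hP hg hsb, permLabel_lt_iff hP hg (fun h => hsb ⟨h.2.1, h.1, h.2.2.symm⟩)]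
  · ext i
    rw [Finset.mem_filter, Finset.mem_filter]
    change _ ∧ P.path.areaWord i < 0 ∧ permLabel g (P.label i) ≠ 0 ↔ _
    rw [ne_eq, permLabel_eq_zero_iff hP]

/-- The inverse descent set of the paths with a given pattern. -/
def patternIdes (L : ℕ → ℕ) (σ : Equiv.Perm (Fin n)) : Finset ℕ :=
  (Finset.univ.filter fun e : Fin n × Fin n => (e.1 + 1 : ℕ) = e.2 ∧
    (L e.1 < L e.2 ∨ (L e.1 = L e.2 ∧ σ⁻¹ e.1 < σ⁻¹ e.2))).image fun e => (e.2 : ℕ)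

theorem ides_eq_patternIdes {L : ℕ → ℕ} {P : LSQ m n} (hP : P ∈ Pref m n)
    (hL : ∀ x, P.level (position hP x) = L x) :
    P.ides = patternIdes L (pattern L hP) := by
  ext i
  rw [mem_ides hP, patternIdes, Finset.mem_image]
  have key : ∀ x y : Fin n, (x + 1 : ℕ) = y → (P.Before (x + 1) (y + 1) ↔
      (L x < L y ∨ (L x = L y ∧ (pattern L hP)⁻¹ x < (pattern L hP)⁻¹ y))) := by
    intro x y hxy
    rw [before_position_iff hP, hL, hL]
    apply or_congr_right
    apply and_congr_right
    intro h
    apply position_lt_iff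
    have := blockIndex_succ L x
    rw [hxy, if_neg (not_not.2 h)] at this
    omega
  constructor
  · rintro ⟨⟨h1, h2⟩, h3⟩
    refine ⟨(⟨i - 1, by omega⟩, ⟨i, h2⟩), ?_, rfl⟩
    rw [Finset.mem_filter]
    have e : i - 1 + 1 = i := by omega
    refine ⟨Finset.mem_univ _, e, ?_⟩
    rw [← key _ _ e]
    simp only [e]
    exact h3
  · rintro ⟨⟨x, y⟩, h, rfl⟩
    rw [Finset.mem_filter] at h
    obtain ⟨-, h1, h2⟩ := h
    rw [← key _ _ h1] at h2
    simp only at h1 h2 ⊢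
    rw [h1] at h2
    exact ⟨⟨by omega, y.2⟩, h2⟩

end LSQ

/-! ### The sum over all shifts -/

/-- A nonempty sum of powers of `q` is nonzero, since its value at `q = 1` is positive. -/
theorem sum_pow_q_ne_zero {ι : Type*} {S : Finset ι} (hS : S.Nonempty) (h : ι → ℕ) :
    ∑ i ∈ S, q ^ h i ≠ 0 := by
  have e : ∑ i ∈ S, q ^ h i =
      algebraMap (MvPolynomial (Fin 2) ℚ) Qqt (∑ i ∈ S, MvPolynomial.X 0 ^ h i) := by
    simp [q]
  rw [e]
  intro h0
  rw [FaithfulSMul.algebraMap_eq_zero_iff] at h0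
  have := congrArg (MvPolynomial.eval fun _ => (1 : ℚ)) h0
  simp only [map_sum, map_pow, MvPolynomial.eval_X, one_pow, Finset.sum_const, nsmul_eq_mul,
    mul_one, map_zero, Nat.cast_eq_zero, Finset.card_eq_zero] at this
  exact hS.ne_empty this

theorem qNat_ne_zero {k : ℕ} (hk : k ≠ 0) : qNat k ≠ 0 :=
  sum_pow_q_ne_zero (Finset.nonempty_range_iff.2 hk) _

theorem qNat_add (a b : ℕ) : qNat (a + b) = qNat a + q ^ a * qNat b := by
  rw [qNat, Finset.sum_range_add, qNat, qNat, Finset.mul_sum]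
  simp [pow_add]

theorem multFactorial_ne_zero (l : List ℕ) : multFactorial l ≠ 0 := by
  induction l with
  | nil => exact one_ne_zero
  | cons v l ih => exact mul_ne_zero (qNat_ne_zero (Nat.succ_ne_zero _)) ih

/-- The number of nonzero labels below level `s`. -/
def nonzeroBelow (C : Multiset (ℕ × ℕ)) (s : ℕ) : ℕ := C.countP fun x => x.1 < s ∧ x.2 ≠ 0

theorem nonzeroBelow_succ (C : Multiset (ℕ × ℕ)) (s : ℕ) : nonzeroBelow C (s + 1) =
    nonzeroBelow C s + (levelLabels C s).countP fun v => v ≠ 0 := by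
  have h : (levelLabels C s).countP (fun v => v ≠ 0) = C.countP fun x => x.1 = s ∧ x.2 ≠ 0 := by
    rw [← countP_levelLetters s (levelLabels C s) fun x => x.2 ≠ 0, levelLetters_levelLabels,
      Multiset.countP_filter]
    apply Multiset.countP_congr rfl
    intro x _
    simp [and_comm]
  rw [h, nonzeroBelow, nonzeroBelow]
  clear h
  induction C using Multiset.induction_on with
  | empty => simp
  | cons x C ih =>
    rw [Multiset.countP_cons, Multiset.countP_cons, Multiset.countP_cons, ih]
    split_ifs <;> omega

theorem sum_qNat_levels (C : Multiset (ℕ × ℕ)) (k : ℕ) :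
    ∑ s ∈ Finset.range k, q ^ nonzeroBelow C s *
      qNat ((levelLabels C s).countP fun v => v ≠ 0) = qNat (nonzeroBelow C k) := by
  induction k with
  | zero => simp [nonzeroBelow, qNat]
  | succ k ih => rw [Finset.sum_range_succ, ih, nonzeroBelow_succ, qNat_add]

namespace LSQ

variable {m n : ℕ}

theorem shiftNat_lt_numLevels (P : LSQ m n) : P.shiftNat < numLevels P.letters := by
  have h := P.isWord_toWord
  rw [toWord, isWord_ofFn_iff P.size_pos] at h
  exact lt_numLevels_iff.2 ⟨_, mem_letters.2 ⟨_, rfl⟩, h.2.2⟩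

theorem nonzeroBelow_numLevels (P : LSQ m n) : nonzeroBelow P.letters (numLevels P.letters) = n := by
  have h1 : nonzeroBelow P.letters (numLevels P.letters) =
      P.letters.countP fun x => ¬ x.2 = 0 := by
    apply Multiset.countP_congr rfl
    intro x hx
    have : x.1 < numLevels P.letters := lt_numLevels_iff.2 ⟨x, hx, le_rfl⟩
    simp [this]
  have h2 := P.letters.card_eq_countP_add_countP fun x => x.2 = 0
  rw [P.countP_label_zero, ← h1, letters, Multiset.card_map] at h2
  simp only [Finset.card_val, Finset.card_univ, Fintype.card_fin] at h2
  have h3 : letters P = Finset.univ.val.map P.letter := rfl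
  rw [← h3] at h2
  omega

/-- The labelled paths of shift `s` are counted by words. -/
theorem sum_pow_dinv (P₀ : LSQ m n) (h₀ : P₀ ∈ Pref m n) (s : ℕ) (S : Finset (LSQ m n))
    (hS : ∀ P, P ∈ S ↔ (P ∈ Pref m n ∧ P.letters = P₀.letters) ∧ P.shiftNat = s) :
    ∑ P ∈ S, q ^ P.dinv = q ^ nonzeroBelow P₀.letters s * wordSum s P₀.letters := by
  classical
  rw [wordSum, genSum, Finset.mul_sum]
  apply Finset.sum_bij fun P _ => P.toWord
  · intro P hP
    obtain ⟨⟨-, h1⟩, rfl⟩ := (hS P).1 hP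
    rw [Finset.mem_filter, mem_arrangements, coe_toWord]
    exact ⟨h1, P.isWord_toWord⟩
  · intro P hP P' hP' h
    exact ext_toWord (((hS P).1 hP).2.trans ((hS P').1 hP').2.symm) h
  · intro l hl
    rw [Finset.mem_filter, mem_arrangements] at hl
    obtain ⟨P, h1, h2⟩ := exists_toWord_eq P₀ hl.2 hl.1
    have h3 : P.letters = P₀.letters := by rw [← coe_toWord, h2, hl.1]
    exact ⟨P, (hS P).2 ⟨⟨mem_Pref_of_letters h3 h₀, h3⟩, h1⟩, h2⟩
  · intro P hP
    obtain ⟨⟨-, h1⟩, rfl⟩ := (hS P).1 hP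
    rw [dinv_eq, h1, pow_add, mul_comm]
    rfl

open Classical in
/-- The contribution of the orders within the blocks, for a function `f` of the inverse descent
set. -/
noncomputable def patternSum {M : Type*} [AddCommMonoid M] [Module Qqt M] (n : ℕ) (L : ℕ → ℕ)
    (f : Finset ℕ → M) : M :=
  ∑ σ ∈ Finset.univ.filter fun σ : Equiv.Perm (Fin n) => PreservesBlocks L σ,
    q ^ patternInv L σ • f (patternIdes L σ)

theorem patternSum_one_ne_zero (n : ℕ) (L : ℕ → ℕ) :
    patternSum n L (fun _ => (1 : Qqt)) ≠ 0 := by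
  classical
  simp only [patternSum, smul_eq_mul, mul_one]
  exact sum_pow_q_ne_zero ⟨1, Finset.mem_filter.2 ⟨Finset.mem_univ _, fun _ => rfl⟩⟩ _

open Classical in
/-- The contribution of everything but the orders within the blocks. -/
noncomputable def crossSum (L : ℕ → ℕ) (S : Finset (LSQ m n)) (hS : ∀ P ∈ S, P ∈ Pref m n) :
    Qqt :=
  ∑ P ∈ S.attach.filter (fun P => pattern L (hS P.1 P.2) = 1), q ^ P.1.crossDinv L

/-- Permuting the labels within the blocks splits off the inverse descent sets: their contribution
is the same for every class of paths that is closed under these permutations. -/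
theorem sum_smul_ides {M : Type*} [AddCommMonoid M] [Module Qqt M] (L : ℕ → ℕ)
    (S : Finset (LSQ m n)) (hS : ∀ P ∈ S, P ∈ Pref m n)
    (hL : ∀ P (h : P ∈ S) x, P.level (position (hS P h) x) = L x)
    (hrel : ∀ P (h : P ∈ S) (g : Equiv.Perm (Fin n)) (hg : PreservesBlocks L g),
      relabel (hS P h) (hL P h) hg ∈ S) (f : Finset ℕ → M) :
    ∑ P ∈ S, q ^ P.dinv • f P.ides = crossSum L S hS • patternSum n L f := by
  classical
  have hcross : ∀ σ : Equiv.Perm (Fin n), PreservesBlocks L σ →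
      ∑ P ∈ S.attach.filter (fun P => pattern L (hS P.1 P.2) = σ), q ^ P.1.crossDinv L =
        crossSum L S hS := by
    intro σ hσ
    symm
    refine Finset.sum_bij'
      (fun P _ => ⟨relabel (hS P.1 P.2) (hL P.1 P.2) hσ, hrel P.1 P.2 σ hσ⟩)
      (fun P _ => ⟨relabel (hS P.1 P.2) (hL P.1 P.2) hσ.inv, hrel P.1 P.2 σ⁻¹ hσ.inv⟩)
      ?_ ?_ ?_ ?_ ?_
    · intro P hP
      rw [Finset.mem_filter] at hP ⊢
      refine ⟨Finset.mem_attach _ _, ?_⟩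
      rw [pattern_relabel (hS P.1 P.2) (hL P.1 P.2) hσ, hP.2, mul_one]
    · intro P hP
      rw [Finset.mem_filter] at hP ⊢
      refine ⟨Finset.mem_attach _ _, ?_⟩
      rw [pattern_relabel (hS P.1 P.2) (hL P.1 P.2) hσ.inv, hP.2, inv_mul_cancel]
    · intro P _
      exact Subtype.ext (relabel_relabel (hS P.1 P.2) (hL P.1 P.2) hσ hσ.inv (by simp))
    · intro P _
      exact Subtype.ext (relabel_relabel (hS P.1 P.2) (hL P.1 P.2) hσ.inv hσ (by simp))
    · intro P _
      rw [crossDinv_relabel]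
  rw [← Finset.sum_attach S, ← Finset.sum_fiberwise S.attach fun P => pattern L (hS P.1 P.2),
    patternSum, Finset.smul_sum, Finset.sum_filter]
  apply Finset.sum_congr rfl
  intro σ _
  split_ifs with hσ
  · rw [← hcross σ hσ, Finset.sum_smul]
    apply Finset.sum_congr rfl
    intro P hP
    rw [Finset.mem_filter] at hP
    rw [dinv_eq_crossDinv_add (hS P.1 P.2) (hL P.1 P.2), ides_eq_patternIdes (hS P.1 P.2)
      (hL P.1 P.2), hP.2, pow_add, mul_smul]
  · apply Finset.sum_eq_zero
    intro P hP
    rw [Finset.mem_filter] at hP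
    exact absurd (hP.2 ▸ preservesBlocks_pattern L (hS P.1 P.2)) hσ

end LSQ

theorem mem_prefWith {m n : ℕ} {τ : List ℕ} {P : LSQ m n} :
    P ∈ prefWith m n τ ↔ P ∈ Pref m n ∧ P.diagWord = τ := by
  simp [prefWith]

theorem mem_parkWith {m n : ℕ} {τ : List ℕ} {P : LSQ m n} :
    P ∈ parkWith m n τ ↔ P ∈ prefWith m n τ ∧ P.shiftNat = 0 := by
  have h1 := P.shiftNat_eq
  have h2 : P.shift = -P.path.base := rfl
  have h3 : P.shift = 0 ↔ P.shiftNat = 0 := by omega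
  rw [mem_prefWith]
  simp only [parkWith, Park, Finset.mem_filter, Set.Finite.mem_toFinset]
  rw [← h3]
  change (P ∈ Pref m n ∧ P.shift = 0) ∧ _ ↔ _
  tauto

end ParkingQ

open ParkingQ in
theorem mainTheorem12 (m n : ℕ) (τ : List ℕ) (hτ : τ ∈ ParkingQ.permWords m n) :
    ∑ P ∈ ParkingQ.prefWith m n τ, P.weight =
      (ParkingQ.qNat n / ParkingQ.qNat (ParkingQ.lastRunNonzero τ)) •
        ∑ D ∈ ParkingQ.parkWith m n τ, D.weight := by
  classical
  rcases (prefWith m n τ).eq_empty_or_nonempty with hempty | ⟨P₀, hP₀⟩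
  · have : parkWith m n τ = ∅ := Finset.eq_empty_of_forall_notMem fun P hP => by
      have := (mem_parkWith.1 hP).1
      rw [hempty] at this
      exact Finset.notMem_empty P this
    rw [hempty, this]
    simp
  obtain ⟨h₀, rfl⟩ := mem_prefWith.1 hP₀
  -- all paths in question have the letters of `P₀`
  have hmem : ∀ P : LSQ m n, P ∈ prefWith m n P₀.diagWord ↔
      P ∈ Pref m n ∧ P.letters = P₀.letters := fun P => by
    rw [mem_prefWith, LSQ.diagWord_eq_iff]
  let S : ℕ → Finset (LSQ m n) := fun s =>
    (prefWith m n P₀.diagWord).filter fun P => P.shiftNat = s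
  have hmemS : ∀ s P, P ∈ S s ↔ (P ∈ Pref m n ∧ P.letters = P₀.letters) ∧ P.shiftNat = s :=
    fun s P => by rw [Finset.mem_filter, hmem]
  have hS : ∀ s, ∀ P ∈ S s, P ∈ Pref m n := fun s P hP => ((hmemS s P).1 hP).1.1
  let L : ℕ → ℕ := fun x => if h : x < n then P₀.level (LSQ.position h₀ ⟨x, h⟩) else 0
  have hL : ∀ s P (h : P ∈ S s) x, P.level (LSQ.position (hS s P h) x) = L x := by
    intro s P h x
    simp only [L, dif_pos x.2]
    exact LSQ.level_position_eq _ _ ((hmemS s P).1 h).1.2 x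
  have hrel : ∀ s P (h : P ∈ S s) (g : Equiv.Perm (Fin n)) (hg : PreservesBlocks L g),
      LSQ.relabel (hS s P h) (hL s P h) hg ∈ S s := by
    intro s P h g hg
    have h' := (hmemS s P).1 h
    refine (hmemS s _).2 ⟨⟨LSQ.relabel_mem_Pref _ _ _, ?_⟩, h'.2⟩
    rw [LSQ.letters_relabel, h'.1.2]
  let F := LSQ.patternSum n L fun I => gesselQ I n
  let F₁ := LSQ.patternSum n L fun _ => (1 : Qqt)
  have hF₁ : F₁ ≠ 0 := LSQ.patternSum_one_ne_zero n L
  obtain ⟨E, hE⟩ := exists_wordSum_content (X := levelLabels P₀.letters) (numLevels P₀.letters)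
    (fun d _ => pairwise_levelLabels _ d) fun d hd => P₀.levelLabels_ne_nil hd
  rw [content_levelLabels] at hE
  let M := ∏ d ∈ Finset.Ico 0 (numLevels P₀.letters), multFactorial (levelLabels P₀.letters d)
  have hM : M ≠ 0 := Finset.prod_ne_zero_iff.2 fun d _ => multFactorial_ne_zero _
  -- the sum over the paths of shift `s`
  have hshift : ∀ s, s < numLevels P₀.letters → ∑ P ∈ S s, P.weight =
      (q ^ nonzeroBelow P₀.letters s *
        qNat ((levelLabels P₀.letters s).countP fun v => v ≠ 0)) •
          (E / (M * F₁)) • t ^ P₀.area • F := by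
    intro s hs
    have h1 : ∑ P ∈ S s, P.weight =
        t ^ P₀.area • ∑ P ∈ S s, q ^ P.dinv • gesselQ P.ides n := by
      rw [Finset.smul_sum]
      apply Finset.sum_congr rfl
      intro P hP
      have : P.area = P₀.area := by
        rw [LSQ.area_eq, LSQ.area_eq, ((hmemS s P).1 hP).1.2]
      rw [LSQ.weight, this, mul_comm, mul_smul]
    have h2 := LSQ.sum_smul_ides L (S s) (hS s) (hL s) (hrel s) fun I => gesselQ I n
    have h3 := LSQ.sum_smul_ides L (S s) (hS s) (hL s) (hrel s) fun _ => (1 : Qqt)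
    simp only [smul_eq_mul, mul_one] at h3
    rw [LSQ.sum_pow_dinv P₀ h₀ s (S s) (hmemS s)] at h3
    have h4 : LSQ.crossSum L (S s) (hS s) = q ^ nonzeroBelow P₀.letters s *
        qNat ((levelLabels P₀.letters s).countP fun v => v ≠ 0) * (E / (M * F₁)) := by
      rw [← mul_div_assoc, eq_div_iff (mul_ne_zero hM hF₁)]
      linear_combination q ^ nonzeroBelow P₀.letters s * hE s hs - M * h3
    rw [h1, h2, h4, smul_comm, mul_smul]
  have hpark : parkWith m n P₀.diagWord = S 0 := by
    ext P
    rw [mem_parkWith, Finset.mem_filter]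
  have htotal : ∑ P ∈ prefWith m n P₀.diagWord, P.weight =
      qNat n • (E / (M * F₁)) • t ^ P₀.area • F := by
    rw [← Finset.sum_fiberwise_of_maps_to (t := Finset.range (numLevels P₀.letters))
      (g := LSQ.shiftNat) fun P hP => ?_]
    · rw [Finset.sum_congr rfl fun s hs => hshift s (Finset.mem_range.1 hs), ← Finset.sum_smul,
        sum_qNat_levels, LSQ.nonzeroBelow_numLevels]
    · rw [Finset.mem_range, ← ((hmem P).1 hP).2]
      exact P.shiftNat_lt_numLevels
  have hr : qNat ((levelLabels P₀.letters 0).countP fun v => v ≠ 0) ≠ 0 := by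
    apply qNat_ne_zero
    obtain ⟨v, hv, hv'⟩ := P₀.exists_base_letter
    rw [← Nat.pos_iff_ne_zero, List.countP_pos_iff]
    exact ⟨v, mem_levelLabels.2 hv', by simpa using hv⟩
  have hbelow : nonzeroBelow P₀.letters 0 = 0 := by simp [nonzeroBelow]
  rw [htotal, hpark, hshift 0 P₀.numLevels_pos, LSQ.lastRunNonzero_diagWord, hbelow, pow_zero,
    one_mul, ← mul_smul (qNat n / _), div_mul_cancel₀ _ hr]
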